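/- **Conventions.** A *generalized quasi-variety* is a class of algebras of a fixed algebraic language axiomatized by a set of generalized quasi-equations (implications from a possibly infinite set of equations to one equation) whose number of variables is bounded by a cardinal; it is a *quasi-variety* if it is axiomatized by generalized quasi-equations with finitely many premises. Such a class is viewed as a category whose arrows are the homomorphisms; if its language has no constant symbols, the empty algebra is one of its objects. For a quasi-variety $\mathsf{K}$, $\boldsymbol{Tm}_{\mathsf{K}}(n)$ denotes the free algebra of $\mathsf{K}$ on $n$ generators, and $\boldsymbol{A}\in\mathsf{K}$ is *finitely presentable* if $\boldsymbol{A}\cong \boldsymbol{Tm}_{\mathsf{K}}(n)/\phi$ for some $n\in\omega$ and some finitely generated $\mathsf{K}$-congruence $\phi$ (a $\mathsf K$-congruence is a congruence whose quotient lies in $\mathsf K$; it is finitely generated if it is the least $\mathsf K$-congruence containing some finite set of pairs). For a cardinal $\kappa>0$, the *matrix power* $\boldsymbol{A}^{[\kappa]}$ of an algebra $\boldsymbol{A}$ has universe $A^{\kappa}$; its $n$-ary basic operations are all $\kappa$-sequences $\langle t_i : i<\kappa\rangle$ of terms in the language of $\boldsymbol{A}$ in the variables $\{x_m^j : 1\le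 m\le n,\ j<\kappa\}$, acting by $\langle t_i : i<\kappa\rangle(a_1,\dots,a_n)=\langle t_i^{\boldsymbol{A}}(a_1/\vec x_1,\dots,a_n/\vec x_n) : i<\kappa\rangle$; homomorphisms act componentwise. Given a class $\mathsf{K}$ of similar algebras, a set $\theta$ of equations in one variable and a sublanguage $\mathscr{L}$ of the language of $\mathsf{K}$, $\theta$ is *compatible* with $\mathscr{L}$ in $\mathsf{K}$ if $\theta(x_1)\cup\dots\cup\theta(x_n)\vDash_{\mathsf{K}}\theta(\varphi(x_1,\dots,x_n))$ for all $n$-ary $\varphi\in\mathscr{L}$; then $\theta_{\mathscr{L}}(\boldsymbol{A})$, for $\boldsymbol{A}\in\mathsf{K}$, is the algebra whose universe is the solution set of $\theta$ in $\boldsymbol{A}$, with the restrictions of the operations in $\mathscr{L}$, and $\theta_{\mathscr{L}}$ acts on homomorphisms by restriction. A functor $\mathcal{G}\colon\mathsf{Y}\to\mathsf{X}$ *decomposes as $\theta_{\mathscr{L}}\circ[\kappa]$* if there is a generalized quasi-variety $\mathsf{K}$ in the language of the $\kappa$-th matrix powers, with $\boldsymbol{A}^{[\kappa]}\in\mathsf{K}$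 for all $\boldsymbol{A}\in\mathsf{Y}$, such that $\theta$ is compatible with $\mathscr{L}$ in $\mathsf{K}$, $\theta_{\mathscr{L}}(\boldsymbol{B})\in\mathsf{X}$ for all $\boldsymbol{B}\in\mathsf{K}$, and $\mathcal{G}$ is naturally isomorphic to the composition of $[\kappa]\colon\mathsf{Y}\to\mathsf{K}$ and $\theta_{\mathscr{L}}\colon\mathsf{K}\to\mathsf{X}$. Here $\mathscr{L}=\{\tau(\psi)\}$ is the image of an arity-preserving map $\tau$ defined on the symbols $\psi$ of the language of $\mathsf{X}$, and $\theta_{\mathscr{L}}(\boldsymbol{B})$ is regarded as an algebra in the language of $\mathsf{X}$ by interpreting $\psi$ as $\tau(\psi)$. An adjunction $\mathcal{F}\dashv\mathcal{G}$ is *trivial* if $\mathcal{F}$ sends every object to an initial object and $\mathcal{G}$ sends every object to a terminal object. **Lemma 5.4.** Let $\mathcal{F}\colon\mathsf{X}\longleftrightarrow\mathsf{Y}\colon\mathcal{G}$ be an adjunction $\mathcal{F}\dashv\mathcal{G}$ between quasi-varieties. The following conditions are equivalent: 1. $\mathcal{F}$ preserves finitely presentable algebras. 2. $\mathcal{F}(\boldsymbol{Tm}_{\mathsf{X}}(1))$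 is finitely presentable. 3. $\mathcal{G}$ preserves directed colimits. If moreover the adjunction is non-trivial, or the language of $\mathsf{Y}$ has a constant symbol, then these are also equivalent to: 4. $\mathcal{G}$ decomposes as $\theta_{\mathscr{L}}\circ[\kappa]$ with both $\kappa>0$ and $\theta$ finite. -/

import Mathlib

universe u w

namespace QuasiVar

open FirstOrder FirstOrder.Language CategoryTheory

/-- An algebra (with possibly empty universe) of the algebraic language `L`.
`L` is a first-order language which is always assumed to have no relation symbols. -/
structure Alg (L : FirstOrder.Language.{u, 0}) where
  /-- The universe of the algebra. -/
  carrier : Type w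
  /-- The basic operations of the algebra. -/
  [str : L.Structure carrier]

attribute [instance] Alg.str

/-- The category of all algebras of the language `L`, with homomorphisms as arrows. -/
instance Alg.category (L : FirstOrder.Language.{u, 0}) : Category (Alg.{u, w} L) where
  Hom A B := L.Hom A.carrier B.carrier
  id A := FirstOrder.Language.Hom.id L A.carrier
  comp f g := FirstOrder.Language.Hom.comp g f

/-- Equations (pairs of terms) in the variables `α`. -/
abbrev Equation (L : FirstOrder.Language.{u, 0}) (α : Type*) := L.Term α × L.Term α

/-- The equation `e` holds in `A` under the assignment `v`. -/
def Equation.HoldsAt {L : FirstOrder.Language.{u, 0}} {α : Type*} (e : Equation L α) (A : Alg.{u, w} L)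
    (v : α → A.carrier) : Prop :=
  e.1.realize v = e.2.realize v

/-- The result of substituting the terms `σ` for the variables in an equation. -/
def Equation.subst {L : FirstOrder.Language.{u, 0}} {α β : Type*} (e : Equation L α) (σ : α → L.Term β) :
    Equation L β :=
  (Term.subst e.1 σ, Term.subst e.2 σ)

/-- The equational consequence `Φ ⊨_K e` relative to the class of algebras `K`. -/
def Entails {L : FirstOrder.Language.{u, 0}} {α : Type*} (K : ObjectProperty (Alg.{u, w} L))
    (Φ : Set (Equation L α)) (e : Equation L α) : Prop :=
  ∀ A : Alg.{u, w} L, K A → ∀ v : α → A.carrier,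
    (∀ p ∈ Φ, Equation.HoldsAt p A v) → Equation.HoldsAt e A v

/-- A generalized quasi-equation: an implication from a (possibly infinite) set of equations to
one equation, written in the variables `α`. -/
structure GenQuasiEquation (L : FirstOrder.Language.{u, 0}) (α : Type*) where
  /-- The equations in the antecedent. -/
  premises : Set (Equation L α)
  /-- The consequent. -/
  conclusion : Equation L α

/-- Validity of a generalized quasi-equation in an algebra. -/
def GenQuasiEquation.Holds {L : FirstOrder.Language.{u, 0}} {α : Type*} (Φ : GenQuasiEquation L α)
    (A : Alg.{u, w} L) : Prop :=
  ∀ v : α → A.carrier,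
    (∀ p ∈ Φ.premises, Equation.HoldsAt p A v) → Equation.HoldsAt Φ.conclusion A v

/-- A generalized quasi-variety is a class of algebras axiomatized by a set of generalized
quasi-equations whose number of variables is bounded: all of them are written in variables from
one set `α`. If the language has no constant symbols then the empty algebra is a member
(every equation then has a variable, so that it has no assignment in the empty algebra). -/
def IsGenQuasivariety {L : FirstOrder.Language.{u, 0}} (K : ObjectProperty (Alg.{u, w} L)) : Prop :=
  ∃ (α : Type u) (S : Set (GenQuasiEquation L α)), ∀ A, K A ↔ ∀ Φ ∈ S, Φ.Holds A

/-- A quasi-variety is a class of algebras axiomatized by quasi-equations, i.e. by generalized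
quasi-equations with a finite antecedent. -/
def IsQuasivariety {L : FirstOrder.Language.{u, 0}} (K : ObjectProperty (Alg.{u, w} L)) : Prop :=
  ∃ S : Set (GenQuasiEquation L ℕ), (∀ Φ ∈ S, Φ.premises.Finite) ∧
    ∀ A, K A ↔ ∀ Φ ∈ S, Φ.Holds A

/-- A congruence of the algebra `A`. -/
structure Congruence {L : FirstOrder.Language.{u, 0}} (A : Alg.{u, w} L) extends Setoid A.carrier where
  /-- Compatibility with the basic operations. -/
  compat : ∀ {n : ℕ} (f : L.Functions n) (x y : Fin n → A.carrier),
    (∀ i, toSetoid (x i) (y i)) → toSetoid (Structure.funMap f x) (Structure.funMap f y)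

instance Congruence.prestructure {L : FirstOrder.Language.{u, 0}} [L.IsAlgebraic] {A : Alg.{u, w} L}
    (θ : Congruence A) : L.Prestructure θ.toSetoid where
  toStructure := A.str
  fun_equiv := fun x y h => θ.compat _ x y h
  rel_equiv := fun {_} {r} => isEmptyElim r

/-- The quotient algebra `A / θ`. -/
def Congruence.quotient {L : FirstOrder.Language.{u, 0}} [L.IsAlgebraic] {A : Alg.{u, w} L}
    (θ : Congruence A) : Alg.{u, w} L where
  carrier := Quotient θ.toSetoid
  str := quotientStructure

/-- `θ` is a `K`-congruence of `A` if `A / θ` belongs to `K`. -/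
def Congruence.IsRelative {L : FirstOrder.Language.{u, 0}} [L.IsAlgebraic] {A : Alg.{u, w} L}
    (K : ObjectProperty (Alg.{u, w} L)) (θ : Congruence A) : Prop :=
  K θ.quotient

/-- The `K`-congruence of `A` generated by `S`: the intersection of all the `K`-congruences of
`A` which contain `S`. -/
def Congruence.generated {L : FirstOrder.Language.{u, 0}} [L.IsAlgebraic] {A : Alg.{u, w} L}
    (K : ObjectProperty (Alg.{u, w} L)) (S : Set (A.carrier × A.carrier)) : Congruence A where
  r a b := ∀ θ : Congruence A, θ.IsRelative K → (∀ p ∈ S, θ.toSetoid p.1 p.2) → θ.toSetoid a b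
  iseqv :=
    { refl := fun a θ _ _ => θ.toSetoid.refl a
      symm := fun h θ h1 h2 => θ.toSetoid.symm (h θ h1 h2)
      trans := fun h h' θ h1 h2 => θ.toSetoid.trans (h θ h1 h2) (h' θ h1 h2) }
  compat := fun f x y h θ h1 h2 => θ.compat f x y fun i => h i θ h1 h2

/-- The absolutely free algebra of terms in the variables `α`. -/
def termAlg (L : FirstOrder.Language.{u, 0}) [L.IsAlgebraic] (α : Type) : Alg.{u, u} L where
  carrier := L.Term α
  str :=
    { funMap := fun f ts => Term.func f ts
      RelMap := fun {_} r => isEmptyElim r }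

/-- The congruence of the term algebra that identifies two terms when they are equal in `K`. -/
def freeCongruence {L : FirstOrder.Language.{u, 0}} [L.IsAlgebraic] (K : ObjectProperty (Alg.{u, u} L))
    (α : Type) : Congruence (termAlg L α) where
  r s t := Entails (L := L) (α := α) K ∅ (s, t)
  iseqv :=
    { refl := fun _ _ _ _ _ => rfl
      symm := fun h A hA v hv => (h A hA v hv).symm
      trans := fun h h' A hA v hv => (h A hA v hv).trans (h' A hA v hv) }
  compat := fun f _ _ h A hA v hv => congrArg (Structure.funMap f) (funext fun i => h i A hA v hv)

/-- The free algebra `Tm_K(α)` of `K` with free generators `α`. -/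
def freeAlg {L : FirstOrder.Language.{u, 0}} [L.IsAlgebraic] (K : ObjectProperty (Alg.{u, u} L))
    (α : Type) : Alg.{u, u} L :=
  (freeCongruence K α).quotient

theorem realize_termAlg {L : FirstOrder.Language.{u, 0}} [L.IsAlgebraic] {α β : Type} (t : L.Term β)
    (σ : β → L.Term α) : t.realize (M := (termAlg L α).carrier) σ = t.subst σ := by
  induction t with
  | var => rfl
  | func f ts ih => exact congrArg (Term.func f) (funext ih)

theorem freeAlg_holdsAt_iff {L : FirstOrder.Language.{u, 0}} [L.IsAlgebraic]
    (K : ObjectProperty (Alg.{u, u} L)) {α β : Type} (e : Equation L β) (σ : β → L.Term α) :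
    Equation.HoldsAt e (freeAlg K α)
        (fun i => Quotient.mk (freeCongruence K α).toSetoid (σ i)) ↔
      ∀ A, K A → ∀ v : α → A.carrier, Equation.HoldsAt e A fun i => (σ i).realize v := by
  have key : ∀ t : L.Term β, t.realize (M := (freeAlg K α).carrier)
      (fun i => Quotient.mk (freeCongruence K α).toSetoid (σ i)) =
        Quotient.mk (freeCongruence K α).toSetoid (t.subst σ) := by
    intro t
    rw [← realize_termAlg]
    exact Term.realize_quotient_mk' (freeCongruence K α).toSetoid t σ
  change _ = _ ↔ _
  rw [key, key]
  refine Iff.trans (Quotient.eq (r := (freeCongruence K α).toSetoid)) ?_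
  constructor
  · intro h A hA v
    have := h A hA v (by simp)
    simpa [Equation.HoldsAt, Term.realize_subst] using this
  · intro h A hA v _
    simpa [Equation.HoldsAt, Term.realize_subst] using h A hA v

/-- The free algebras of a quasi-variety belong to it. -/
theorem IsQuasivariety.freeAlg_mem {L : FirstOrder.Language.{u, 0}} [L.IsAlgebraic]
    {K : ObjectProperty (Alg.{u, u} L)} (hK : IsQuasivariety K) (α : Type) :
    K (freeAlg K α) := by
  obtain ⟨S, -, hS⟩ := hK
  refine (hS _).2 fun Φ hΦ v hv => ?_
  obtain ⟨σ, rfl⟩ : ∃ σ : ℕ → L.Term α,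
      v = fun i => Quotient.mk (freeCongruence K α).toSetoid (σ i) :=
    ⟨fun i => (v i).out, funext fun i => (Quotient.out_eq (v i)).symm⟩
  rw [freeAlg_holdsAt_iff]
  intro A hA w
  refine (hS A).1 hA Φ hΦ _ fun p hp => ?_
  exact (freeAlg_holdsAt_iff K p σ).1 (hv p hp) A hA w

/-- The free algebra `Tm_K(α)` as an object of the quasi-variety `K`. -/
def IsQuasivariety.free {L : FirstOrder.Language.{u, 0}} [L.IsAlgebraic]
    {K : ObjectProperty (Alg.{u, u} L)} (hK : IsQuasivariety K) (α : Type) :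
    K.FullSubcategory :=
  ⟨freeAlg K α, hK.freeAlg_mem α⟩

/-- `A` is `K`-finitely presentable: it is isomorphic to the quotient of a finitely generated
free algebra `Tm_K(n)` under a finitely generated `K`-congruence. -/
def IsFinPresentable {L : FirstOrder.Language.{u, 0}} [L.IsAlgebraic] (K : ObjectProperty (Alg.{u, u} L))
    (A : K.FullSubcategory) : Prop :=
  ∃ (n : ℕ) (S : Set ((freeAlg K (Fin n)).carrier × (freeAlg K (Fin n)).carrier)), S.Finite ∧
    Nonempty (L.Equiv A.obj.carrier (Congruence.generated K S).quotient.carrier)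

/-- The functor `G` preserves directed colimits, i.e. colimits of diagrams indexed by (non-empty)
directed posets. -/
def PreservesDirectedColimits {C D : Type*} [Category.{u} C] [Category.{u} D] (G : C ⥤ D) :
    Prop :=
  ∀ (J : Type u) [PartialOrder J] [IsDirectedOrder J] [Nonempty J],
    Limits.PreservesColimitsOfShape J G

/-- An adjoint pair is trivial if the left adjoint sends everything to the initial object and
the right adjoint sends everything to the terminal object. -/
def IsTrivialPair {C D : Type*} [Category C] [Category D] (F : C ⥤ D) (G : D ⥤ C) : Prop :=
  (∀ A, Nonempty (Limits.IsInitial (F.obj A))) ∧ ∀ B, Nonempty (Limits.IsTerminal (G.obj B))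

/-- The language of the `κ`-th matrix power, for an exponent `κ` given as an index set: its `n`-ary operations are the `κ`-sequences of
terms of `L` in the variables `x_m^j` with `m < n` and `j < κ`. -/
def matrixLang (L : FirstOrder.Language.{u, 0}) (κ : Type) : FirstOrder.Language.{u, 0} where
  Functions n := κ → L.Term (Fin n × κ)
  Relations _ := Empty

instance (L : FirstOrder.Language.{u, 0}) (κ : Type) : (matrixLang L κ).IsAlgebraic :=
  fun _ => inferInstanceAs (IsEmpty Empty)

/-- The matrix power `A^[κ]`, whose universe is `A^κ`. -/
def matrixPower {L : FirstOrder.Language.{u, 0}} (κ : Type) (A : Alg.{u, u} L) :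
    Alg.{u, u} (matrixLang L κ) where
  carrier := κ → A.carrier
  str :=
    { funMap := fun {n} (t : κ → L.Term (Fin n × κ)) (a : Fin n → κ → A.carrier) (i : κ) =>
        (t i).realize fun p => a p.1 p.2
      RelMap := fun {_} r => isEmptyElim r }

/-- The functor `[κ]`, on the category of all algebras; a homomorphism is applied
component-wise. -/
def matrixPowerFunctor (L : FirstOrder.Language.{u, 0}) (κ : Type) :
    Alg.{u, u} L ⥤ Alg.{u, u} (matrixLang L κ) where
  obj A := matrixPower κ A
  map {A B} f :=
    { toFun := fun (a : κ → A.carrier) (i : κ) =>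
        FirstOrder.Language.Hom.toFun (M := A.carrier) (N := B.carrier) f (a i)
      map_fun' := fun {n} (t : κ → L.Term (Fin n × κ)) (a : Fin n → κ → A.carrier) =>
        funext fun i => (HomClass.realize_term (L := L) (M := A.carrier) (N := B.carrier)
          (F := L.Hom A.carrier B.carrier) f (t := t i) (v := fun p => a p.1 p.2)).symm
      map_rel' := fun {_} r => isEmptyElim r }

/-- The solution set in `A` of a set `θ` of equations in one variable. -/
def solutions {L : FirstOrder.Language.{u, 0}} (θ : Set (Equation L (Fin 1))) (A : Alg.{u, w} L) :
    Set A.carrier :=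
  {a | ∀ e ∈ θ, Equation.HoldsAt e A fun _ => a}

/-- Compatibility of `θ` in `K` with the sublanguage of `L'` that consists of the symbols
`τ ψ`, for `ψ` in `L`: for every `n`-ary `ψ`,
`θ(x_1) ∪ … ∪ θ(x_n) ⊨_K θ((τ ψ)(x_1, …, x_n))`. -/
def IsCompatible {L L' : FirstOrder.Language.{u, 0}} (τ : L →ᴸ L') (θ : Set (Equation L' (Fin 1)))
    (K : ObjectProperty (Alg.{u, w} L')) : Prop :=
  ∀ (n : ℕ) (ψ : L.Functions n), ∀ e ∈ θ,
    Entails K {q | ∃ i : Fin n, ∃ p ∈ θ, q = Equation.subst p fun _ => Term.var i}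
      (Equation.subst e fun _ => Term.func (τ.onFunction ψ) Term.var)

theorem IsCompatible.funMap_mem {L L' : FirstOrder.Language.{u, 0}} {τ : L →ᴸ L'}
    {θ : Set (Equation L' (Fin 1))} {K : ObjectProperty (Alg.{u, w} L')}
    (h : IsCompatible τ θ K) {A : Alg.{u, w} L'} (hA : K A) {n : ℕ} (ψ : L.Functions n)
    (a : Fin n → A.carrier) (ha : ∀ i, a i ∈ solutions θ A) :
    Structure.funMap (τ.onFunction ψ) a ∈ solutions θ A := by
  intro e he
  have := h n ψ e he A hA a ?_
  · simpa [Equation.HoldsAt, Equation.subst, Term.realize_subst] using this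
  · rintro q ⟨i, p, hp, rfl⟩
    simpa [Equation.HoldsAt, Equation.subst, Term.realize_subst] using ha i p hp

/-- The algebra `θ_𝓛(A)` for `A` in `K`, where `𝓛` is the sublanguage of `L'` that consists of
the symbols `τ ψ`: its universe is the solution set of `θ` in `A`, and the operations are the
restrictions of the operations in `𝓛`. It is seen as an algebra of the language `L`, where `ψ`
names the operation `τ ψ`. -/
def thetaAlg {L L' : FirstOrder.Language.{u, 0}} [L.IsAlgebraic] {τ : L →ᴸ L'}
    {θ : Set (Equation L' (Fin 1))} {K : ObjectProperty (Alg.{u, w} L')}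
    (h : IsCompatible τ θ K) (A : K.FullSubcategory) : Alg.{u, w} L where
  carrier := solutions θ A.obj
  str :=
    { funMap := fun ψ a => ⟨Structure.funMap (τ.onFunction ψ) fun i => (a i).1,
        h.funMap_mem A.property ψ _ fun i => (a i).2⟩
      RelMap := fun {_} r => isEmptyElim r }

theorem map_mem_solutions {L : FirstOrder.Language.{u, 0}} [L.IsAlgebraic] (θ : Set (Equation L (Fin 1)))
    {A B : Alg.{u, w} L} (f : L.Hom A.carrier B.carrier) {a : A.carrier}
    (ha : a ∈ solutions θ A) : f a ∈ solutions θ B := by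
  intro e he
  have h := congrArg f (ha e he)
  rw [← HomClass.realize_term, ← HomClass.realize_term] at h
  exact h

/-- The functor `θ_𝓛`, sending a homomorphism to its restriction to the solution sets. -/
def thetaFunctor {L L' : FirstOrder.Language.{u, 0}} [L.IsAlgebraic] [L'.IsAlgebraic] {τ : L →ᴸ L'}
    {θ : Set (Equation L' (Fin 1))} {K : ObjectProperty (Alg.{u, w} L')}
    (h : IsCompatible τ θ K) : K.FullSubcategory ⥤ Alg.{u, w} L where
  obj A := thetaAlg h A
  map {A B} f :=
    { toFun := fun a : solutions θ A.obj =>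
        (⟨FirstOrder.Language.Hom.toFun (M := A.obj.carrier) (N := B.obj.carrier) f.hom a.1,
          map_mem_solutions θ (A := A.obj) (B := B.obj) f.hom a.2⟩ : solutions θ B.obj)
      map_fun' := fun ψ a => Subtype.ext
        (FirstOrder.Language.Hom.map_fun (M := A.obj.carrier) (N := B.obj.carrier) f.hom (τ.onFunction ψ)
          fun i => (a i).1)
      map_rel' := fun {_} r => isEmptyElim r }

/-- `G : Y ⥤ X` decomposes as `θ_𝓛 ∘ [k]` with finite exponent `k > 0` and a finite set `θ` of
equations in one variable: there are a generalized quasi-variety `K` in the language of the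
matrix power and functors `[k] : Y ⥤ K` and `θ_𝓛 : K ⥤ X`, where `θ` is compatible with `𝓛` in
`K`, such that `G` is naturally isomorphic to their composition. The sublanguage `𝓛` consists of
the symbols `τ ψ`, for `ψ` in the language of `X`. -/
def DecomposesFinitely {LX LY : FirstOrder.Language.{u, 0}} [LX.IsAlgebraic] [LY.IsAlgebraic]
    (X : ObjectProperty (Alg.{u, u} LX)) (Y : ObjectProperty (Alg.{u, u} LY))
    (G : Y.FullSubcategory ⥤ X.FullSubcategory) : Prop :=
  ∃ (k : ℕ) (_ : 0 < k)
    (K : ObjectProperty (Alg.{u, u} (matrixLang LY (Fin k)))) (_ : IsGenQuasivariety K)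
    (hY : ∀ A : Y.FullSubcategory, K (matrixPower (Fin k) A.obj))
    (τ : LX →ᴸ matrixLang LY (Fin k))
    (θ : Set (Equation (matrixLang LY (Fin k)) (Fin 1))) (_ : θ.Finite)
    (hθ : IsCompatible τ θ K)
    (hX : ∀ B : K.FullSubcategory, X (thetaAlg hθ B)),
    Nonempty (G ≅ K.lift (Y.ι ⋙ matrixPowerFunctor LY (Fin k)) hY ⋙ X.lift (thetaFunctor hθ) hX)

end QuasiVar

set_option linter.unusedSectionVars false

namespace QuasiVar

open FirstOrder FirstOrder.Language CategoryTheory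

/-! ### Presentations by generators and equations relative to a quasi-variety -/

section Presentations

variable {L : FirstOrder.Language.{u, 0}}

/-! The adjunction makes `G` representable on underlying sets: the elements of `G B` are the
homomorphisms from the free algebra on one generator to `G B`, hence the homomorphisms from `F
(Tm_X(1))` to `B`. If `F (Tm_X(1))` is presented by `n` generators and a finite set `E` of
equations, then `G B` is, naturally in `B`, the set of solutions of `E` in `B ^ n`. This
description, called `Represents`, is the hub of the proof.

In quasi-varieties directed colimits are computed on sets, because operations are finitary and
quasi-equations have finitely many premises. Finite tuples and finitely many equalities are
therefore witnessed at one stage, so solution sets of finite systems commute with directed colimits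
(`Represents.preservesDirectedColimits`).

Conversely, an algebra is finitely presentable as soon as its arrows to directed colimits factor
through a stage (`LiftsThroughDirected.isFinPresentable`). When `G` preserves directed colimits,
this factorization property passes from `A` to `F A` along the adjunction.

For the decomposition, an operation of `G B` is natural in `B`, so by a Yoneda argument it is given
by terms on coordinates (`Represents.exists_terms`). Thus `G B` is cut out by equations inside a
matrix power. In the other direction, a finite `θ` on a finite matrix power unfolds to a finite `E`.
Only `n = 0` needs care, since the exponent must be positive: a constant supplies a dummy
coordinate, and without constants the adjunction is trivial. -/

theorem map_realize {M N : Type*} [L.Structure M] [L.Structure N] (f : M →[L] N) {α : Type*}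
    (t : L.Term α) (v : α → M) : f (t.realize v) = t.realize fun i => f (v i) :=
  (HomClass.realize_term f).symm

theorem map_funMap {M N : Type*} [L.Structure M] [L.Structure N] (f : M →[L] N) {n : ℕ}
    (ψ : L.Functions n) (x : Fin n → M) :
    f (Structure.funMap ψ x) = Structure.funMap ψ fun i => f (x i) :=
  f.map_fun ψ x

theorem Equation.HoldsAt.map {A B : Alg.{u, u} L} {α : Type*} {e : Equation L α}
    {v : α → A.carrier} (h : e.HoldsAt A v) (f : A.carrier →[L] B.carrier) :
    e.HoldsAt B fun i => f (v i) := by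
  have := congrArg f h
  rwa [map_realize, map_realize] at this

theorem Equation.holdsAt_map_iff {A B : Alg.{u, u} L} {α : Type*} {e : Equation L α}
    {v : α → A.carrier} (f : A.carrier →[L] B.carrier) :
    (e.HoldsAt B fun i => f (v i)) ↔ f (e.1.realize v) = f (e.2.realize v) := by
  rw [map_realize, map_realize]; rfl

/-- The assignment `v` satisfies all the equations in `E`. -/
def Satisfies {α : Type*} (E : Set (Equation L α)) (A : Alg.{u, u} L) (v : α → A.carrier) : Prop :=
  ∀ e ∈ E, Equation.HoldsAt e A v

theorem Satisfies.map {A B : Alg.{u, u} L} {α : Type*} {E : Set (Equation L α)}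
    {v : α → A.carrier} (h : Satisfies E A v) (f : A.carrier →[L] B.carrier) :
    Satisfies E B fun i => f (v i) :=
  fun e he => (h e he).map f

variable [L.IsAlgebraic]

/-- Homomorphisms of algebras, from maps that preserve the operations. -/
def mkHom {M N : Type*} [L.Structure M] [L.Structure N] (f : M → N)
    (h : ∀ {n : ℕ} (ψ : L.Functions n) (x : Fin n → M),
      f (Structure.funMap ψ x) = Structure.funMap ψ fun i => f (x i)) : M →[L] N where
  toFun := f
  map_fun' := h
  map_rel' r := isEmptyElim r

/-- Bijective homomorphisms of algebras are isomorphisms. -/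
noncomputable def equivOfBijective {M N : Type*} [L.Structure M] [L.Structure N] (f : M →[L] N)
    (hf : Function.Bijective f) : M ≃[L] N where
  toEquiv := _root_.Equiv.ofBijective f hf
  map_fun' ψ x := f.map_fun ψ x
  map_rel' r := isEmptyElim r

/-- Closure under subalgebras of products, in a form that needs no products: premises travel along
each homomorphism, and the conclusion, true in every target, is pulled back by separation. All later
proofs that a quotient or subalgebra lies in `K` go through this. -/
theorem IsQuasivariety.mem_of_separated {K : ObjectProperty (Alg.{u, u} L)} (hK : IsQuasivariety K)
    {A : Alg.{u, u} L} (h : ∀ a b : A.carrier,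
      (∀ B, K B → ∀ f : A.carrier →[L] B.carrier, f a = f b) → a = b) : K A := by
  obtain ⟨S, -, hS⟩ := hK
  refine (hS A).2 fun Φ hΦ v hv => h _ _ fun B hB f => ?_
  rw [map_realize, map_realize]
  exact (hS B).1 hB Φ hΦ _ fun p hp => (hv p hp).map f

theorem IsQuasivariety.mem_of_injective {K : ObjectProperty (Alg.{u, u} L)}
    (hK : IsQuasivariety K) {A B : Alg.{u, u} L} (hB : K B) (f : A.carrier →[L] B.carrier)
    (hf : Function.Injective f) : K A :=
  hK.mem_of_separated fun _ _ h => hf (h B hB f)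

namespace Congruence

/-- The projection to the quotient algebra. -/
def proj {A : Alg.{u, u} L} (θ : Congruence A) : A.carrier →[L] θ.quotient.carrier :=
  mkHom (fun a => Quotient.mk θ.toSetoid a) fun ψ x => (funMap_quotient_mk' θ.toSetoid ψ x).symm

theorem proj_surjective {A : Alg.{u, u} L} (θ : Congruence A) : Function.Surjective θ.proj :=
  Quotient.mk_surjective

theorem proj_eq_iff {A : Alg.{u, u} L} (θ : Congruence A) {a b : A.carrier} :
    θ.proj a = θ.proj b ↔ θ.toSetoid a b :=
  Quotient.eq (r := θ.toSetoid)

/-- The factorization of a homomorphism through a quotient. -/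
def lift {A B : Alg.{u, u} L} (θ : Congruence A) (f : A.carrier →[L] B.carrier)
    (h : ∀ a b, θ.toSetoid a b → f a = f b) : θ.quotient.carrier →[L] B.carrier :=
  mkHom (Quotient.lift f h) fun ψ x => by
    obtain ⟨y, rfl⟩ : ∃ y : _ → A.carrier, x = fun i => θ.proj (y i) :=
      ⟨fun i => (x i).out, funext fun i => (Quotient.out_eq (x i)).symm⟩
    have : Structure.funMap ψ (fun i => θ.proj (y i)) = θ.proj (Structure.funMap ψ y) :=
      (θ.proj.map_fun ψ y).symm
    rw [this]
    exact f.map_fun ψ y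

/-- The kernel of a homomorphism. -/
def ker {A B : Alg.{u, u} L} (f : A.carrier →[L] B.carrier) : Congruence A where
  r a b := f a = f b
  iseqv := ⟨fun _ => rfl, Eq.symm, Eq.trans⟩
  compat ψ x y h := by
    rw [f.map_fun, f.map_fun]
    exact congrArg _ (funext h)

theorem ker_isRelative {K : ObjectProperty (Alg.{u, u} L)} (hK : IsQuasivariety K)
    {A B : Alg.{u, u} L} (hB : K B) (f : A.carrier →[L] B.carrier) : (ker f).IsRelative K := by
  refine hK.mem_of_injective hB ((ker f).lift f fun _ _ h => h) fun a b h => ?_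
  obtain ⟨a, rfl⟩ := (ker f).proj_surjective a
  obtain ⟨b, rfl⟩ := (ker f).proj_surjective b
  exact (ker f).proj_eq_iff.2 h

/-- The projections onto the quotients by the `K`-congruences containing `S` factor through this
quotient and separate its points. -/
theorem generated_isRelative {K : ObjectProperty (Alg.{u, u} L)} (hK : IsQuasivariety K)
    {A : Alg.{u, u} L} (S : Set (A.carrier × A.carrier)) : (generated K S).IsRelative K := by
  refine hK.mem_of_separated fun a b h => ?_
  obtain ⟨a, rfl⟩ := (generated K S).proj_surjective a
  obtain ⟨b, rfl⟩ := (generated K S).proj_surjective b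
  refine (proj_eq_iff _).2 fun θ hθ hS => ?_
  exact θ.proj_eq_iff.1
    (h θ.quotient hθ ((generated K S).lift θ.proj fun _ _ h => θ.proj_eq_iff.2 (h θ hθ hS)))

end Congruence

/-- `A` is presented, relative to `K`, by the generators `v` and the equations `E`. -/
structure IsPresentedBy (K : ObjectProperty (Alg.{u, u} L)) {α : Type} (A : Alg.{u, u} L)
    (v : α → A.carrier) (E : Set (Equation L α)) : Prop where
  satisfies : Satisfies E A v
  generates : ∀ a, ∃ t : L.Term α, t.realize v = a
  entails : ∀ s t : L.Term α, s.realize v = t.realize v → Entails (L := L) K E (s, t)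

/-- The homomorphism out of a presented algebra given by values of the generators. -/
theorem IsPresentedBy.exists_hom {K : ObjectProperty (Alg.{u, u} L)} {α : Type} {A : Alg.{u, u} L}
    {v : α → A.carrier} {E : Set (Equation L α)} (h : IsPresentedBy K A v E) {B : Alg.{u, u} L}
    (hB : K B) {w : α → B.carrier} (hw : Satisfies E B w) :
    ∃ f : A.carrier →[L] B.carrier, ∀ t : L.Term α, f (t.realize v) = t.realize w := by
  choose r hr using h.generates
  have key : ∀ (a : A.carrier) (t : L.Term α), t.realize v = a → (r a).realize w = t.realize w :=
    fun a t hat => h.entails (r a) t ((hr a).trans hat.symm) B hB w hw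
  refine ⟨mkHom (fun a => (r a).realize w) fun ψ x => ?_, fun t => key _ t rfl⟩
  rw [key _ (Term.func ψ fun i => r (x i)) (by simp [hr])]
  rfl

theorem IsPresentedBy.hom_ext {K : ObjectProperty (Alg.{u, u} L)} {α : Type} {A : Alg.{u, u} L}
    {v : α → A.carrier} {E : Set (Equation L α)} (h : IsPresentedBy K A v E) {M : Type*}
    [L.Structure M] {f g : A.carrier →[L] M} (hfg : ∀ i, f (v i) = g (v i)) (a : A.carrier) :
    f a = g a := by
  obtain ⟨t, rfl⟩ := h.generates a
  rw [map_realize, map_realize, funext hfg]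

/-- The congruence of the term algebra that identifies two terms when `E` entails in `K` that they
are equal. -/
def presCongruence (K : ObjectProperty (Alg.{u, u} L)) {α : Type} (E : Set (Equation L α)) :
    Congruence (termAlg L α) where
  r s t := Entails (L := L) (α := α) K E (s, t)
  iseqv :=
    { refl := fun _ _ _ _ _ => rfl
      symm := fun h A hA v hv => (h A hA v hv).symm
      trans := fun h h' A hA v hv => (h A hA v hv).trans (h' A hA v hv) }
  compat := fun f _ _ h A hA v hv => congrArg (Structure.funMap f) (funext fun i => h i A hA v hv)

/-- The class of a term in the presented algebra. -/
def presMk (K : ObjectProperty (Alg.{u, u} L)) {α : Type} (E : Set (Equation L α))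
    (t : L.Term α) : (presCongruence K E).quotient.carrier :=
  (presCongruence K E).proj t

theorem presMk_surjective (K : ObjectProperty (Alg.{u, u} L)) {α : Type} (E : Set (Equation L α)) :
    Function.Surjective (presMk K E) :=
  (presCongruence K E).proj_surjective

theorem presMk_eq_iff (K : ObjectProperty (Alg.{u, u} L)) {α : Type} (E : Set (Equation L α))
    {s t : L.Term α} : presMk K E s = presMk K E t ↔ Entails (L := L) K E (s, t) :=
  (presCongruence K E).proj_eq_iff

theorem realize_presMk (K : ObjectProperty (Alg.{u, u} L)) {α : Type}
    (E : Set (Equation L α)) (t : L.Term α) :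
    t.realize (fun i => presMk K E (Term.var i)) = presMk K E t := by
  induction t with
  | var => rfl
  | func f ts ih =>
    simp only [Term.realize_func, ih]
    exact ((presCongruence K E).proj.map_fun f ts).symm

/-- Evaluation of terms is a homomorphism. -/
def evalHom {α : Type} {B : Alg.{u, u} L} (w : α → B.carrier) :
    (termAlg L α).carrier →[L] B.carrier :=
  mkHom (fun t : L.Term α => t.realize w) fun _ _ => rfl

theorem presCongruence_isPresentedBy (K : ObjectProperty (Alg.{u, u} L)) {α : Type}
    (E : Set (Equation L α)) :
    IsPresentedBy K (presCongruence K E).quotient (fun i => presMk K E (Term.var i)) E where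
  satisfies e he := by
    unfold Equation.HoldsAt
    rw [realize_presMk, realize_presMk, presMk_eq_iff]
    exact fun A _ v hv => hv e he
  generates a := by
    obtain ⟨t, rfl⟩ := presMk_surjective K E a
    exact ⟨t, realize_presMk K E t⟩
  entails s t h := by
    rw [realize_presMk, realize_presMk, presMk_eq_iff] at h
    exact h

theorem IsQuasivariety.presCongruence_isRelative {K : ObjectProperty (Alg.{u, u} L)}
    (hK : IsQuasivariety K) {α : Type} (E : Set (Equation L α)) :
    (presCongruence K E).IsRelative K := by
  refine hK.mem_of_separated fun a b h => ?_
  obtain ⟨a, rfl⟩ := (presCongruence K E).proj_surjective a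
  obtain ⟨b, rfl⟩ := (presCongruence K E).proj_surjective b
  refine (Congruence.proj_eq_iff _).2 fun B hB w hw => ?_
  exact h B hB ((presCongruence K E).lift (evalHom w) fun s t hst => hst B hB w hw)

theorem freeAlg_isPresentedBy (K : ObjectProperty (Alg.{u, u} L)) (α : Type) :
    ∃ v : α → (freeAlg K α).carrier, IsPresentedBy K (freeAlg K α) v ∅ :=
  ⟨_, presCongruence_isPresentedBy K ∅⟩

/-- The hypothesis `hSE` says that `S` and `E` impose the same condition on homomorphisms out of the
free algebra. To test an entailment in `B`, the assignment is extended to the free algebra; its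
kernel is one of the `K`-congruences intersected in `Congruence.generated`. -/
theorem generated_isPresentedBy {K : ObjectProperty (Alg.{u, u} L)} (hK : IsQuasivariety K)
    {α : Type} {v : α → (freeAlg K α).carrier} (hv : IsPresentedBy K (freeAlg K α) v ∅)
    {S : Set ((freeAlg K α).carrier × (freeAlg K α).carrier)} {E : Set (Equation L α)}
    (hSE : ∀ (B : Alg.{u, u} L) (f : (freeAlg K α).carrier →[L] B.carrier),
      (∀ p ∈ S, f p.1 = f p.2) ↔ Satisfies E B fun i => f (v i)) :
    IsPresentedBy K (Congruence.generated K S).quotient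
      (fun i => (Congruence.generated K S).proj (v i)) E where
  satisfies := (hSE _ (Congruence.generated K S).proj).1 fun p hp =>
    (Congruence.proj_eq_iff _).2 fun _ _ h => h p hp
  generates a := by
    obtain ⟨a, rfl⟩ := (Congruence.generated K S).proj_surjective a
    obtain ⟨t, rfl⟩ := hv.generates a
    exact ⟨t, (map_realize _ t v).symm⟩
  entails s t h B hB w hw := by
    rw [← map_realize, ← map_realize, Congruence.proj_eq_iff] at h
    obtain ⟨f, hf⟩ := hv.exists_hom hB (w := w) (by simp [Satisfies])
    have hfv : (fun i => f (v i)) = w := funext fun i => hf (Term.var i)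
    have := h (Congruence.ker f) (Congruence.ker_isRelative hK hB f)
      ((hSE B f).2 (by rw [hfv]; exact hw))
    exact (hf s).symm.trans (this.trans (hf t))

theorem IsPresentedBy.nonempty_equiv {K : ObjectProperty (Alg.{u, u} L)} {α : Type}
    {A B : Alg.{u, u} L} {v : α → A.carrier} {w : α → B.carrier} {E : Set (Equation L α)}
    (hA : IsPresentedBy K A v E) (hB : IsPresentedBy K B w E) (hKA : K A) (hKB : K B) :
    Nonempty (A.carrier ≃[L] B.carrier) := by
  obtain ⟨f, hf⟩ := hA.exists_hom hKB hB.satisfies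
  refine ⟨equivOfBijective f ⟨fun a b h => ?_, fun b => ?_⟩⟩
  · obtain ⟨s, rfl⟩ := hA.generates a
    obtain ⟨t, rfl⟩ := hA.generates b
    rw [hf, hf] at h
    exact hB.entails s t h A hKA v hA.satisfies
  · obtain ⟨t, rfl⟩ := hB.generates b
    exact ⟨_, hf t⟩

theorem IsPresentedBy.of_equiv {K : ObjectProperty (Alg.{u, u} L)} {α : Type}
    {A B : Alg.{u, u} L} {w : α → B.carrier} {E : Set (Equation L α)}
    (hB : IsPresentedBy K B w E) (e : A.carrier ≃[L] B.carrier) :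
    IsPresentedBy K A (fun i => e.symm (w i)) E := by
  have h : ∀ t : L.Term α, t.realize (fun i => e.symm (w i)) = e.symm (t.realize w) :=
    fun t => (map_realize e.symm.toHom t w).symm
  refine ⟨fun p hp => ?_, fun a => ?_, fun s t hst => ?_⟩
  · exact (hB.satisfies p hp).map e.symm.toHom
  · obtain ⟨t, ht⟩ := hB.generates (e a)
    exact ⟨t, by rw [h, ht, e.symm_apply_apply]⟩
  · rw [h, h] at hst
    exact hB.entails s t (e.symm.injective hst)

/-- Pairs of elements of the free algebra become equations by choosing terms for them, and equations
become pairs by evaluation at the generators; both passages keep finiteness. -/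
theorem isFinPresentable_iff {K : ObjectProperty (Alg.{u, u} L)} (hK : IsQuasivariety K)
    (A : K.FullSubcategory) :
    IsFinPresentable K A ↔ ∃ (n : ℕ) (v : Fin n → A.obj.carrier) (E : Set (Equation L (Fin n))),
      E.Finite ∧ IsPresentedBy K A.obj v E := by
  constructor
  · rintro ⟨n, S, hS, ⟨e⟩⟩
    obtain ⟨v, hv⟩ := freeAlg_isPresentedBy K (Fin n)
    choose r hr using hv.generates
    refine ⟨n, _, (fun p : _ × _ => (r p.1, r p.2)) '' S, hS.image _,
      (generated_isPresentedBy hK hv (S := S) fun B f => ?_).of_equiv e⟩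
    simp only [Satisfies, Set.forall_mem_image]
    refine forall₂_congr fun p _ => (Iff.trans (Equation.holdsAt_map_iff f) ?_).symm
    rw [hr, hr]
  · rintro ⟨n, w, E, hE, hA⟩
    obtain ⟨v, hv⟩ := freeAlg_isPresentedBy K (Fin n)
    refine ⟨n, (fun p : Equation L (Fin n) => (p.1.realize v, p.2.realize v)) '' E, hE.image _,
      hA.nonempty_equiv (generated_isPresentedBy hK hv fun B f => ?_) A.property
        (Congruence.generated_isRelative hK _)⟩
    simp only [Satisfies, Set.forall_mem_image]
    exact forall₂_congr fun p _ => (Equation.holdsAt_map_iff f).symm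

end Presentations

/-! ### Arrows of a quasi-variety as homomorphisms -/

section FullSubcategory

variable {L : FirstOrder.Language.{u, 0}} {K : ObjectProperty (Alg.{u, u} L)}

/-- The homomorphism underlying an arrow of a full subcategory of algebras. -/
def asHom {A B : K.FullSubcategory} (f : A ⟶ B) : A.obj.carrier →[L] B.obj.carrier := f.hom

/-- The arrow given by a homomorphism. -/
def ofHom {A B : K.FullSubcategory} (f : A.obj.carrier →[L] B.obj.carrier) : A ⟶ B :=
  ObjectProperty.homMk f

@[simp] theorem asHom_comp {A B C : K.FullSubcategory} (f : A ⟶ B) (g : B ⟶ C)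
    (x : A.obj.carrier) : asHom (f ≫ g) x = asHom g (asHom f x) := rfl

@[simp] theorem asHom_id (A : K.FullSubcategory) (x : A.obj.carrier) : asHom (𝟙 A) x = x := rfl

theorem arrow_ext {A B : K.FullSubcategory} {f g : A ⟶ B} (h : ∀ x, asHom f x = asHom g x) :
    f = g :=
  ObjectProperty.hom_ext _ (FirstOrder.Language.Hom.ext h)

theorem asHom_injective_of_iso {A B : K.FullSubcategory} (e : A ≅ B) :
    Function.Injective (asHom e.hom) := by
  intro x y h
  have := congrArg (asHom e.inv) h
  rwa [← asHom_comp, ← asHom_comp, e.hom_inv_id] at this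

theorem asHom_surjective_of_iso {A B : K.FullSubcategory} (e : A ≅ B) :
    Function.Surjective (asHom e.hom) := fun x =>
  ⟨asHom e.inv x, by rw [← asHom_comp, e.inv_hom_id, asHom_id]⟩

end FullSubcategory

/-! ### Directed colimits are computed on underlying sets -/

section DirectedColimits

variable {L : FirstOrder.Language.{u, 0}} {K : ObjectProperty (Alg.{u, u} L)}
  {J : Type u} [PartialOrder J] {D : J ⥤ K.FullSubcategory}

/-- A cocone under a directed diagram of algebras which is a directed colimit on the level of
sets. -/
structure IsConcrete (c : Limits.Cocone D) : Prop where
  exists_rep : ∀ x : c.pt.obj.carrier, ∃ (j : J) (y : (D.obj j).obj.carrier),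
    asHom (c.ι.app j) y = x
  exists_eq : ∀ (j : J) (y y' : (D.obj j).obj.carrier),
    asHom (c.ι.app j) y = asHom (c.ι.app j) y' →
      ∃ (k : J) (f : j ⟶ k), asHom (D.map f) y = asHom (D.map f) y'

theorem diagram_map_map {i j k : J} (f : i ⟶ j) (g : j ⟶ k) (h : i ⟶ k)
    (y : (D.obj i).obj.carrier) : asHom (D.map g) (asHom (D.map f) y) = asHom (D.map h) y := by
  rw [← asHom_comp, ← D.map_comp, Subsingleton.elim (f ≫ g) h]

theorem cocone_app_map (c : Limits.Cocone D) {j k : J} (f : j ⟶ k) (y : (D.obj j).obj.carrier) :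
    asHom (c.ι.app k) (asHom (D.map f) y) = asHom (c.ι.app j) y := by
  rw [← asHom_comp, c.w]

variable [IsDirectedOrder J] [Nonempty J]

namespace IsConcrete

variable {c : Limits.Cocone D}

theorem exists_rep_finite (hc : IsConcrete c) {ι : Type*} [Finite ι]
    (x : ι → c.pt.obj.carrier) :
    ∃ (j : J) (y : ι → (D.obj j).obj.carrier), (fun i => asHom (c.ι.app j) (y i)) = x := by
  choose j y hy using fun i => hc.exists_rep (x i)
  obtain ⟨k, hk⟩ := Finite.exists_le j
  exact ⟨k, fun i => asHom (D.map (homOfLE (hk i))) (y i),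
    funext fun i => (cocone_app_map c (homOfLE (hk i)) (y i)).trans (hy i)⟩

theorem exists_eq_finite (hc : IsConcrete c) {ι : Type*} [Finite ι] {j : J}
    {y y' : ι → (D.obj j).obj.carrier}
    (h : ∀ i, asHom (c.ι.app j) (y i) = asHom (c.ι.app j) (y' i)) :
    ∃ (k : J) (f : j ⟶ k), ∀ i, asHom (D.map f) (y i) = asHom (D.map f) (y' i) := by
  choose k f hf using fun i => hc.exists_eq j (y i) (y' i) (h i)
  obtain ⟨m, hm⟩ := Finite.exists_le k
  obtain ⟨m', hm', hj⟩ := exists_ge_ge m j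
  refine ⟨m', homOfLE hj, fun i => ?_⟩
  have := congrArg (asHom (D.map (homOfLE ((hm i).trans hm')))) (hf i)
  rwa [diagram_map_map _ _ (homOfLE hj), diagram_map_map _ _ (homOfLE hj)] at this

/-- Each equation true in the colimit is an equality of two elements of one stage, which holds from
some later stage on; finitely many equations have a common one. -/
theorem exists_satisfies (hc : IsConcrete c) {α : Type*} {E : Set (Equation L α)}
    (hE : E.Finite) {j : J} {w : α → (D.obj j).obj.carrier}
    (h : Satisfies E c.pt.obj fun i => asHom (c.ι.app j) (w i)) :
    ∃ (k : J) (f : j ⟶ k), Satisfies E (D.obj k).obj fun i => asHom (D.map f) (w i) := by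
  have := hE.to_subtype
  obtain ⟨k, f, hf⟩ := hc.exists_eq_finite (ι := E) (y := fun e => e.1.1.realize w)
    (y' := fun e => e.1.2.realize w)
    fun e => (Equation.holdsAt_map_iff _).1 (h e.1 e.2)
  exact ⟨k, f, fun e he => (Equation.holdsAt_map_iff _).2 (hf ⟨e, he⟩)⟩

theorem exists_eq_of_app_eq (hc : IsConcrete c) {i j : J} {y : (D.obj i).obj.carrier}
    {z : (D.obj j).obj.carrier} (h : asHom (c.ι.app i) y = asHom (c.ι.app j) z) :
    ∃ (k : J) (f : i ⟶ k) (g : j ⟶ k), asHom (D.map f) y = asHom (D.map g) z := by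
  obtain ⟨m, hi, hj⟩ := exists_ge_ge i j
  obtain ⟨k, f, hf⟩ := hc.exists_eq m (asHom (D.map (homOfLE hi)) y)
    (asHom (D.map (homOfLE hj)) z) (by rw [cocone_app_map, cocone_app_map, h])
  refine ⟨k, homOfLE hi ≫ f, homOfLE hj ≫ f, ?_⟩
  rwa [diagram_map_map _ _ (homOfLE hi ≫ f), diagram_map_map _ _ (homOfLE hj ≫ f)] at hf

theorem cocone_app_eq (hc : IsConcrete c) (s : Limits.Cocone D) {i j : J}
    {y : (D.obj i).obj.carrier} {z : (D.obj j).obj.carrier}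
    (h : asHom (c.ι.app i) y = asHom (c.ι.app j) z) :
    asHom (s.ι.app i) y = asHom (s.ι.app j) z := by
  obtain ⟨k, f, g, hfg⟩ := hc.exists_eq_of_app_eq h
  rw [← cocone_app_map s f, ← cocone_app_map s g, hfg]

theorem exists_desc [L.IsAlgebraic] (hc : IsConcrete c) (s : Limits.Cocone D) :
    ∃ f : c.pt ⟶ s.pt, ∀ j, c.ι.app j ≫ f = s.ι.app j := by
  choose r y hy using hc.exists_rep
  have key : ∀ (j : J) (z : (D.obj j).obj.carrier), asHom (s.ι.app (r (asHom (c.ι.app j) z)))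
      (y (asHom (c.ι.app j) z)) = asHom (s.ι.app j) z :=
    fun j z => hc.cocone_app_eq s (hy _)
  refine ⟨ofHom (mkHom (fun x => asHom (s.ι.app (r x)) (y x)) fun ψ x => ?_),
    fun j => arrow_ext (key j)⟩
  obtain ⟨j, z, rfl⟩ := hc.exists_rep_finite x
  simp only [key]
  rw [← map_funMap, ← map_funMap, key]

theorem nonempty_isColimit [L.IsAlgebraic] (hc : IsConcrete c) :
    Nonempty (Limits.IsColimit c) := by
  choose d hd using fun s => hc.exists_desc s
  refine ⟨⟨d, hd, fun s m hm => arrow_ext fun x => ?_⟩⟩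
  obtain ⟨j, y, rfl⟩ := hc.exists_rep x
  rw [← asHom_comp, ← asHom_comp, hm, hd]

end IsConcrete

variable (D) in
/-- The equivalence relation on the disjoint union of a directed diagram whose quotient is the
directed colimit. -/
def dirLimSetoid : Setoid (Σ j, (D.obj j).obj.carrier) where
  r x y := ∃ (k : J) (f : x.1 ⟶ k) (g : y.1 ⟶ k), asHom (D.map f) x.2 = asHom (D.map g) y.2
  iseqv :=
    { refl := fun x => ⟨x.1, 𝟙 _, 𝟙 _, rfl⟩
      symm := fun ⟨k, f, g, h⟩ => ⟨k, g, f, h.symm⟩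
      trans := by
        rintro x y z ⟨k, f, g, h⟩ ⟨k', f', g', h'⟩
        obtain ⟨m, hk, hk'⟩ := exists_ge_ge k k'
        refine ⟨m, f ≫ homOfLE hk, g' ≫ homOfLE hk', ?_⟩
        rw [← diagram_map_map f (homOfLE hk), h, ← diagram_map_map g' (homOfLE hk'), ← h',
          diagram_map_map g _ (g ≫ homOfLE hk), diagram_map_map f' _ (g ≫ homOfLE hk)] }

variable (D) in
/-- The universe of the direct limit of a directed diagram of algebras. -/
def DirLim : Type u := Quotient (dirLimSetoid D)

/-- The element of the direct limit that is given by an element of one stage. -/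
def DirLim.of {j : J} (y : (D.obj j).obj.carrier) : DirLim D :=
  Quotient.mk (dirLimSetoid D) ⟨j, y⟩

namespace DirLim

theorem of_eq_of_iff {i j : J} {y : (D.obj i).obj.carrier} {z : (D.obj j).obj.carrier} :
    (of y : DirLim D) = of z ↔
      ∃ (k : J) (f : i ⟶ k) (g : j ⟶ k), asHom (D.map f) y = asHom (D.map g) z :=
  Quotient.eq (r := dirLimSetoid D)

theorem of_map {i j : J} (f : i ⟶ j) (y : (D.obj i).obj.carrier) :
    (of (asHom (D.map f) y) : DirLim D) = of y :=
  of_eq_of_iff.2 ⟨j, 𝟙 j, f, by rw [D.map_id]; rfl⟩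

theorem exists_rep {ι : Type*} [Finite ι] (x : ι → DirLim D) :
    ∃ (j : J) (y : ι → (D.obj j).obj.carrier), (fun i => of (y i)) = x := by
  obtain ⟨k, hk⟩ := Finite.exists_le fun i => (x i).out.1
  exact ⟨k, fun i => asHom (D.map (homOfLE (hk i))) (x i).out.2,
    funext fun i => (of_map _ _).trans (Quotient.out_eq (x i))⟩

theorem exists_eq {ι : Type*} [Finite ι] {i j : J} {y : ι → (D.obj i).obj.carrier}
    {z : ι → (D.obj j).obj.carrier} (h : ∀ a, (of (y a) : DirLim D) = of (z a)) :
    ∃ (k : J) (f : i ⟶ k) (g : j ⟶ k),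
      ∀ a, asHom (D.map f) (y a) = asHom (D.map g) (z a) := by
  choose k f g hfg using fun a => of_eq_of_iff.1 (h a)
  obtain ⟨m, hm⟩ := Finite.exists_le k
  obtain ⟨m₁, hmm₁, hi⟩ := exists_ge_ge m i
  obtain ⟨m₂, hm₂, hj⟩ := exists_ge_ge m₁ j
  refine ⟨m₂, homOfLE (hi.trans hm₂), homOfLE hj, fun a => ?_⟩
  have := congrArg (asHom (D.map (homOfLE ((hm a).trans (hmm₁.trans hm₂))))) (hfg a)
  rwa [diagram_map_map _ _ (homOfLE (hi.trans hm₂)), diagram_map_map _ _ (homOfLE hj)] at this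

variable [L.IsAlgebraic]

/-- The arguments are lifted to a common stage by choice; `funMap_of` shows that the choice is
immaterial. -/
noncomputable instance : L.Structure (DirLim D) where
  funMap ψ x := of (Structure.funMap ψ (exists_rep x).choose_spec.choose)
  RelMap r := isEmptyElim r

theorem funMap_of {j : J} {n : ℕ} (ψ : L.Functions n) (y : Fin n → (D.obj j).obj.carrier) :
    (Structure.funMap ψ fun i => (of (y i) : DirLim D)) = of (Structure.funMap ψ y) := by
  have h := (exists_rep fun i => (of (y i) : DirLim D)).choose_spec.choose_spec
  change of (Structure.funMap ψ (exists_rep fun i => (of (y i) : DirLim D)).choose_spec.choose) = _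
  set z := (exists_rep fun i => (of (y i) : DirLim D)).choose_spec.choose
  obtain ⟨k, f, g, hfg⟩ := exists_eq fun i => congrFun h i
  refine of_eq_of_iff.2 ⟨k, f, g, ?_⟩
  rw [Hom.map_fun, Hom.map_fun]
  exact congrArg _ (funext hfg)

/-- The canonical homomorphism from a stage to the direct limit. -/
noncomputable def ofHom (j : J) : (D.obj j).obj.carrier →[L] DirLim D :=
  mkHom of fun ψ y => (funMap_of ψ y).symm

end DirLim

/-- Quasi-equations are written in countably many variables, but an infinite assignment in a direct
limit need not come from a single stage. Only the finitely many variables that occur have to be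
lifted. -/
theorem exists_vars_bound (t : L.Term ℕ) : ∃ N, ∀ (M : Type u) [L.Structure M] (v w : ℕ → M),
    (∀ i < N, v i = w i) → t.realize v = t.realize w := by
  induction t with
  | var i => exact ⟨i + 1, fun M _ v w h => h i i.lt_succ_self⟩
  | func f ts ih =>
    choose N hN using ih
    obtain ⟨B, hB⟩ := Finite.exists_le N
    exact ⟨B, fun M _ v w h => congrArg _ (funext fun i =>
      hN i M v w fun a ha => h a (ha.trans_le (hB i)))⟩

theorem exists_vars_bound_finite {E : Set (Equation L ℕ)} (hE : E.Finite) :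
    ∃ N, ∀ (A : Alg.{u, u} L) (v w : ℕ → A.carrier), (∀ i < N, v i = w i) →
      ∀ e ∈ E, (Equation.HoldsAt e A v ↔ Equation.HoldsAt e A w) := by
  choose N hN using fun t : L.Term ℕ => exists_vars_bound t
  have := hE.to_subtype
  obtain ⟨B, hB⟩ := Finite.exists_le fun e : E => max (N e.1.1) (N e.1.2)
  refine ⟨B, fun A v w h e he => ?_⟩
  have hB := hB ⟨e, he⟩
  simp only [max_le_iff] at hB
  unfold Equation.HoldsAt
  rw [hN e.1 A.carrier v w fun i hi => h i (hi.trans_le hB.1),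
    hN e.2 A.carrier v w fun i hi => h i (hi.trans_le hB.2)]

theorem IsQuasivariety.dirLim_mem [L.IsAlgebraic] (hK : IsQuasivariety K) (D : J ⥤ K.FullSubcategory) :
    K ⟨DirLim D⟩ := by
  obtain ⟨S, hfin, hS⟩ := hK
  refine (hS _).2 fun Φ hΦ v hv => ?_
  obtain ⟨N, hN⟩ := exists_vars_bound_finite ((hfin Φ hΦ).insert Φ.conclusion)
  -- One index more than needed: `Fin (N + 1)` is never empty, so `Fin.ofNat` extends `y` to an
  -- assignment of all of `ℕ`, with irrelevant values from `N` on.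
  obtain ⟨j, y, hy⟩ := DirLim.exists_rep fun i : Fin (N + 1) => v i
  have hagree : ∀ i < N, (DirLim.of (y (Fin.ofNat (N + 1) i)) : DirLim D) = v i := by
    intro i hi
    have := congrFun hy (Fin.ofNat (N + 1) i)
    simpa [Nat.mod_eq_of_lt (hi.trans N.lt_succ_self)] using this
  set w : ℕ → (D.obj j).obj.carrier := fun i => y (Fin.ofNat (N + 1) i)
  have hw := hN ⟨DirLim D⟩ (fun i => DirLim.ofHom j (w i)) v hagree
  have hfinite := (hfin Φ hΦ).to_subtype
  have hprem : ∀ p : Φ.premises, (DirLim.of (p.1.1.realize w) : DirLim D) =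
      DirLim.of (p.1.2.realize w) := fun p =>
    (Equation.holdsAt_map_iff (B := ⟨DirLim D⟩) (DirLim.ofHom j)).1
      ((hw p (Set.mem_insert_of_mem _ p.2)).2 (hv p p.2))
  obtain ⟨k, f, g, hfg⟩ := DirLim.exists_eq hprem
  have hcon := (hS _).1 (D.obj k).property Φ hΦ (fun i => asHom (D.map f) (w i)) fun p hp =>
    (Equation.holdsAt_map_iff _).2 ((hfg ⟨p, hp⟩).trans (by rw [Subsingleton.elim g f]))
  refine (hw Φ.conclusion (Set.mem_insert _ _)).1 ?_
  have := hcon.map (B := ⟨DirLim D⟩) (DirLim.ofHom k)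
  have hmap : (fun i => DirLim.ofHom k (asHom (D.map f) (w i))) =
      fun i => (DirLim.ofHom j (w i) : DirLim D) := funext fun i => DirLim.of_map f (w i)
  rwa [hmap] at this

theorem IsQuasivariety.exists_isConcrete [L.IsAlgebraic] (hK : IsQuasivariety K)
    (D : J ⥤ K.FullSubcategory) : ∃ c : Limits.Cocone D, IsConcrete c := by
  refine ⟨⟨⟨⟨DirLim D⟩, hK.dirLim_mem D⟩, ⟨fun j => ofHom (DirLim.ofHom j), fun i j f =>
    arrow_ext fun y => DirLim.of_map f y⟩⟩, fun x => ?_, fun j y y' h => ?_⟩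
  · obtain ⟨j, y, hy⟩ := DirLim.exists_rep fun _ : Unit => (x : DirLim D)
    exact ⟨j, y (), congrFun hy ()⟩
  · obtain ⟨k, f, g, hfg⟩ := DirLim.of_eq_of_iff.1 h
    exact ⟨k, f, by rw [hfg, Subsingleton.elim g f]⟩

/-- Any colimit is isomorphic to the set-level direct limit, which lies in `K` by `dirLim_mem`, and
concreteness transfers along the isomorphism. -/
theorem IsQuasivariety.isConcrete_of_isColimit [L.IsAlgebraic] (hK : IsQuasivariety K)
    {c : Limits.Cocone D} (hc : Limits.IsColimit c) : IsConcrete c := by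
  obtain ⟨c', hc'⟩ := hK.exists_isConcrete D
  obtain ⟨h'⟩ := hc'.nonempty_isColimit
  have he : ∀ (j : J) (y : (D.obj j).obj.carrier),
      asHom (hc.coconePointUniqueUpToIso h').hom (asHom (c.ι.app j) y) =
        asHom (c'.ι.app j) y := fun j y => by
    rw [← asHom_comp, hc.comp_coconePointUniqueUpToIso_hom]
  refine ⟨fun x => ?_, fun j y y' h => hc'.exists_eq j y y' ?_⟩
  · obtain ⟨j, y, hy⟩ := hc'.exists_rep (asHom (hc.coconePointUniqueUpToIso h').hom x)
    exact ⟨j, y, asHom_injective_of_iso _ ((he j y).trans hy)⟩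
  · rw [← he, ← he, h]

end DirectedColimits

/-! ### Finite presentability as factorization through directed colimits -/

section FinitePresentability

variable {L : FirstOrder.Language.{u, 0}} [L.IsAlgebraic] {K : ObjectProperty (Alg.{u, u} L)}

/-- Every arrow from `B` to a directed colimit factors through a stage. -/
def LiftsThroughDirected (B : K.FullSubcategory) : Prop :=
  ∀ (J : Type u) [PartialOrder J] [IsDirectedOrder J] [Nonempty J] (D : J ⥤ K.FullSubcategory)
    (c : Limits.Cocone D), IsConcrete c → ∀ f : B ⟶ c.pt,
      ∃ (j : J) (g : B ⟶ D.obj j), g ≫ c.ι.app j = f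

theorem IsPresentedBy.liftsThroughDirected {B : K.FullSubcategory} {n : ℕ}
    {v : Fin n → B.obj.carrier} {E : Set (Equation L (Fin n))} (h : IsPresentedBy K B.obj v E)
    (hE : E.Finite) : LiftsThroughDirected B := by
  intro J _ _ _ D c hc f
  obtain ⟨j, w, hw⟩ := hc.exists_rep_finite fun i => asHom f (v i)
  obtain ⟨k, g, hg⟩ := hc.exists_satisfies hE (w := w) (by rw [hw]; exact h.satisfies.map _)
  obtain ⟨φ, hφ⟩ := h.exists_hom (D.obj k).property hg
  refine ⟨k, ofHom φ, arrow_ext fun a => ?_⟩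
  rw [asHom_comp]
  refine h.hom_ext (f := (asHom (c.ι.app k)).comp φ) (fun i => ?_) a
  have : φ (v i) = asHom (D.map g) (w i) := hφ (Term.var i)
  rw [FirstOrder.Language.Hom.comp_apply, this, cocone_app_map]
  exact congrFun hw i

/-- The diagram of the finitely generated subalgebras of `B`. -/
def subalgebraDiagram (hK : IsQuasivariety K) (B : K.FullSubcategory) :
    Finset B.obj.carrier ⥤ K.FullSubcategory where
  obj s := ⟨⟨Substructure.closure L (s : Set B.obj.carrier)⟩,
    hK.mem_of_injective B.property (Substructure.subtype _).toHom Subtype.val_injective⟩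
  map f := ofHom (Substructure.inclusion
    ((Substructure.closure L).monotone (Finset.coe_subset.2 (leOfHom f)))).toHom

/-- The cocone of the finitely generated subalgebras of `B`. -/
def subalgebraCocone (hK : IsQuasivariety K) (B : K.FullSubcategory) :
    Limits.Cocone (subalgebraDiagram hK B) where
  pt := B
  ι := { app := fun _ => ofHom (Substructure.subtype _).toHom }

theorem subalgebraCocone_isConcrete (hK : IsQuasivariety K) (B : K.FullSubcategory) :
    IsConcrete (subalgebraCocone hK B) where
  exists_rep x := ⟨({x} : Finset B.obj.carrier),
    ⟨x, Substructure.subset_closure (Finset.mem_coe.2 (Finset.mem_singleton_self _))⟩, rfl⟩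
  exists_eq j _ _ h := ⟨j, 𝟙 j, congrArg _ (Subtype.ext h)⟩

/-- `B` is the directed union of its finitely generated subalgebras; factoring the identity through
one of them shows that it is all of `B`. -/
theorem LiftsThroughDirected.exists_generators (hK : IsQuasivariety K) {B : K.FullSubcategory}
    (hB : LiftsThroughDirected B) :
    ∃ (n : ℕ) (v : Fin n → B.obj.carrier), ∀ b, ∃ t : L.Term (Fin n), t.realize v = b := by
  classical
  obtain ⟨s, g, hg⟩ := hB _ _ _ (subalgebraCocone_isConcrete hK B) (𝟙 B)
  refine ⟨s.card, fun i => (s.equivFin.symm i).1, fun b => ?_⟩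
  have hb : b ∈ Substructure.closure L (s : Set B.obj.carrier) := by
    have h : asHom (g ≫ (subalgebraCocone hK B).ι.app s) b = b := by rw [hg]; rfl
    rw [← h]
    exact (asHom g b).2
  obtain ⟨t, rfl⟩ := Substructure.mem_closure_iff_exists_term.1 hb
  refine ⟨t.relabel s.equivFin, ?_⟩
  rw [Term.realize_relabel]
  exact congrArg (fun w => Term.realize w t) (funext fun i => by simp)

/-- The homomorphism between presented algebras when the set of equations grows. -/
def presMap (K : ObjectProperty (Alg.{u, u} L)) {α : Type} {E E' : Set (Equation L α)}
    (h : E ⊆ E') : (presCongruence K E).quotient.carrier →[L]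
      (presCongruence K E').quotient.carrier :=
  (presCongruence K E).lift (presCongruence K E').proj fun _ _ hst =>
    (Congruence.proj_eq_iff _).2 fun A hA w hw => hst A hA w fun p hp => hw p (h hp)

/-- The homomorphism from a presented algebra to `B` that is given by an assignment. -/
def presEval {α : Type} {E : Set (Equation L α)} {B : Alg.{u, u} L} (hB : K B)
    {v : α → B.carrier} (hv : Satisfies E B v) :
    (presCongruence K E).quotient.carrier →[L] B.carrier :=
  (presCongruence K E).lift (evalHom v) fun _ _ hst => hst B hB v hv

/-- A finite set of equations that hold under `v`, as a set of equations. -/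
def equationsOf {α : Type} {B : Alg.{u, u} L} {v : α → B.carrier}
    (s : Finset {e : Equation L α // e.HoldsAt B v}) : Set (Equation L α) :=
  Subtype.val '' (s : Set {e : Equation L α // e.HoldsAt B v})

theorem satisfies_equationsOf {α : Type} {B : Alg.{u, u} L} {v : α → B.carrier}
    (s : Finset {e : Equation L α // e.HoldsAt B v}) : Satisfies (equationsOf s) B v := by
  rintro _ ⟨e, -, rfl⟩
  exact e.2

/-- The diagram of the algebras presented by finitely many of the equations that hold under an
assignment `v` in `B`. -/
def presDiagram (hK : IsQuasivariety K) {α : Type} (B : K.FullSubcategory)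
    (v : α → B.obj.carrier) :
    Finset {e : Equation L α // e.HoldsAt B.obj v} ⥤ K.FullSubcategory where
  obj s := ⟨(presCongruence K (equationsOf s)).quotient, hK.presCongruence_isRelative _⟩
  map f := ofHom (presMap K (Set.image_mono (Finset.coe_subset.2 (leOfHom f))))
  map_id s := arrow_ext fun x => by
    obtain ⟨t, rfl⟩ := presMk_surjective K _ x
    rfl
  map_comp f g := arrow_ext fun x => by
    obtain ⟨t, rfl⟩ := presMk_surjective K _ x
    rfl

/-- The cocone from the algebras presented by finitely many equations that hold in `B`. -/
def presCocone (hK : IsQuasivariety K) {α : Type} (B : K.FullSubcategory)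
    (v : α → B.obj.carrier) : Limits.Cocone (presDiagram hK B v) where
  pt := B
  ι :=
    { app := fun s => ofHom (presEval B.property (satisfies_equationsOf s))
      naturality := fun s s' f => arrow_ext fun x => by
        obtain ⟨t, rfl⟩ := presMk_surjective K _ x
        rfl }

theorem presCocone_isConcrete (hK : IsQuasivariety K) {α : Type} (B : K.FullSubcategory)
    (v : α → B.obj.carrier) (hv : ∀ b, ∃ t : L.Term α, t.realize v = b) :
    IsConcrete (presCocone hK B v) where
  exists_rep x := by
    obtain ⟨t, rfl⟩ := hv x
    exact ⟨∅, presMk K _ t, rfl⟩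
  exists_eq s x y h := by
    classical
    obtain ⟨t, rfl⟩ := presMk_surjective K _ x
    obtain ⟨t', rfl⟩ := presMk_surjective K _ y
    -- Two terms with the same value in `B` are identified as soon as their equation is added to the
    -- finite set.
    refine ⟨insert ⟨(t, t'), h⟩ s, homOfLE (Finset.subset_insert _ _), ?_⟩
    refine (presMk_eq_iff K _).2 fun A _ w hw => hw _ ?_
    exact ⟨⟨(t, t'), h⟩, by simp, rfl⟩

/-- `B` is the directed colimit of the algebras presented by finitely many of its equations, so the
identity has a section `g` into one of them. The elements `g (v i)` and the formal generators agree
in `B`, hence at a later stage `s'`; there `t.realize v` is sent to the class of `t`, so the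
equations in `s'` entail all the others. -/
theorem LiftsThroughDirected.isFinPresentable (hK : IsQuasivariety K) {B : K.FullSubcategory}
    (hB : LiftsThroughDirected B) : IsFinPresentable K B := by
  obtain ⟨n, v, hv⟩ := hB.exists_generators hK
  have hc := presCocone_isConcrete hK B v hv
  obtain ⟨s, g, hg⟩ := hB _ _ _ hc (𝟙 B)
  obtain ⟨s', f, hf⟩ := hc.exists_eq_finite (y := fun i => asHom g (v i))
    (y' := fun i => presMk K (equationsOf s) (Term.var i)) fun i => by
      rw [← asHom_comp, hg]; rfl
  have key : ∀ t : L.Term (Fin n),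
      asHom (g ≫ (presDiagram hK B v).map f) (t.realize v) = presMk K (equationsOf s') t := by
    intro t
    rw [map_realize, ← realize_presMk]
    exact congrArg (fun w => Term.realize w t) (funext hf)
  refine (isFinPresentable_iff hK B).2 ⟨n, v, equationsOf s', s'.finite_toSet.image _,
    satisfies_equationsOf s', hv, fun p q hpq => ?_⟩
  rw [← presMk_eq_iff, ← key, ← key, hpq]

end FinitePresentability

/-! ### Finite presentability and directed colimits across the adjunction -/

section Adjunction

variable {LX LY : FirstOrder.Language.{u, 0}} [LX.IsAlgebraic] [LY.IsAlgebraic]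
  {X : ObjectProperty (Alg.{u, u} LX)} {Y : ObjectProperty (Alg.{u, u} LY)}
  {F : X.FullSubcategory ⥤ Y.FullSubcategory} {G : Y.FullSubcategory ⥤ X.FullSubcategory}

theorem PreservesDirectedColimits.isConcrete_mapCocone (hX : IsQuasivariety X)
    (hG : PreservesDirectedColimits G) {J : Type u} [PartialOrder J] [IsDirectedOrder J]
    [Nonempty J] {D : J ⥤ Y.FullSubcategory} {c : Limits.Cocone D} (hc : IsConcrete c) :
    IsConcrete (G.mapCocone c) := by
  obtain ⟨h⟩ := hc.nonempty_isColimit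
  have := hG J
  exact hX.isConcrete_of_isColimit (Limits.isColimitOfPreserves G h)

/-- An arrow from `F A` to a directed colimit transposes to an arrow from `A` to the image of the
colimit under `G`, again a directed colimit; it factors there, and the factor is transposed back. -/
theorem preserves_finPresentable (hX : IsQuasivariety X) (hY : IsQuasivariety Y) (adj : F ⊣ G)
    (hG : PreservesDirectedColimits G) (A : X.FullSubcategory) (hA : IsFinPresentable X A) :
    IsFinPresentable Y (F.obj A) := by
  obtain ⟨n, v, E, hE, h⟩ := (isFinPresentable_iff hX A).1 hA
  refine LiftsThroughDirected.isFinPresentable hY fun J _ _ _ D c hc f => ?_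
  obtain ⟨j, g, hg⟩ := h.liftsThroughDirected hE J (D ⋙ G) (G.mapCocone c)
    (hG.isConcrete_mapCocone hX hc) (adj.homEquiv _ _ f)
  refine ⟨j, (adj.homEquiv _ _).symm g, ?_⟩
  rw [← adj.homEquiv_naturality_right_symm, Equiv.symm_apply_eq]
  exact hg

theorem free_isFinPresentable (hX : IsQuasivariety X) (n : ℕ) :
    IsFinPresentable X (hX.free (Fin n)) := by
  obtain ⟨v, hv⟩ := freeAlg_isPresentedBy X (Fin n)
  exact (isFinPresentable_iff hX _).2 ⟨n, v, ∅, Set.finite_empty, hv⟩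

/-- The maps `σ` identify the universes of the algebras `G B` naturally with the sets of solutions
of `E` in `B`. -/
structure Represents (G : Y.FullSubcategory ⥤ X.FullSubcategory) {n : ℕ}
    (E : Set (Equation LY (Fin n)))
    (σ : ∀ B : Y.FullSubcategory, (G.obj B).obj.carrier → Fin n → B.obj.carrier) : Prop where
  natural : ∀ {B C : Y.FullSubcategory} (f : B ⟶ C) (x : (G.obj B).obj.carrier),
    σ C (asHom (G.map f) x) = fun i => asHom f (σ B x i)
  injective : ∀ B, Function.Injective (σ B)
  satisfies : ∀ B x, Satisfies E B.obj (σ B x)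
  exists_eq : ∀ (B : Y.FullSubcategory) (w : Fin n → B.obj.carrier), Satisfies E B.obj w →
    ∃ x, σ B x = w

theorem exists_represents (hX : IsQuasivariety X) (hY : IsQuasivariety Y) (adj : F ⊣ G)
    (h : IsFinPresentable Y (F.obj (hX.free (Fin 1)))) :
    ∃ (n : ℕ) (E : Set (Equation LY (Fin n))) (σ : _), E.Finite ∧ Represents G E σ := by
  obtain ⟨n, v, E, hE, hv⟩ := (isFinPresentable_iff hY _).1 h
  obtain ⟨g, hg⟩ : ∃ g : Fin 1 → (hX.free (Fin 1)).obj.carrier,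
    IsPresentedBy X (hX.free (Fin 1)).obj g ∅ := freeAlg_isPresentedBy X (Fin 1)
  have hom_ext : ∀ {A : X.FullSubcategory} {f f' : hX.free (Fin 1) ⟶ A},
      asHom f (g 0) = asHom f' (g 0) → f = f' := fun h =>
    arrow_ext (hg.hom_ext fun i => by rwa [Subsingleton.elim i 0])
  have : ∀ (B : Y.FullSubcategory) (x : (G.obj B).obj.carrier),
      ∃ f : hX.free (Fin 1) ⟶ G.obj B, asHom f (g 0) = x := fun B x => by
    obtain ⟨f, hf⟩ := hg.exists_hom (G.obj B).property (w := fun _ => x) (by simp [Satisfies])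
    exact ⟨ofHom f, hf (Term.var 0)⟩
  -- `φ B x` is the arrow from the free algebra that sends its generator to `x`; its transpose,
  -- evaluated at the generators `v`, gives the coordinates of `x`.
  choose φ hφ using this
  refine ⟨n, E, fun B x i => asHom ((adj.homEquiv _ _).symm (φ B x)) (v i), hE,
    fun {B C} f x => funext fun i => ?_, fun B x y hxy => ?_, fun B x => hv.satisfies.map _,
    fun B w hw => ?_⟩
  · rw [← asHom_comp, ← adj.homEquiv_naturality_right_symm]
    congr 3
    exact hom_ext (by rw [hφ, asHom_comp, hφ])
  · have : φ B x = φ B y :=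
      (adj.homEquiv _ _).symm.injective (arrow_ext (hv.hom_ext (congrFun hxy)))
    rw [← hφ B x, ← hφ B y, this]
  · obtain ⟨f, hf⟩ := hv.exists_hom B.property hw
    refine ⟨asHom (adj.homEquiv _ _ (ofHom f)) (g 0), funext fun i => ?_⟩
    rw [hom_ext (hφ B _), Equiv.symm_apply_apply]
    exact hf (Term.var i)

theorem Represents.preservesDirectedColimits (hY : IsQuasivariety Y) {n : ℕ}
    {E : Set (Equation LY (Fin n))}
    {σ : ∀ B : Y.FullSubcategory, (G.obj B).obj.carrier → Fin n → B.obj.carrier}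
    (h : Represents G E σ) (hE : E.Finite) : PreservesDirectedColimits G := by
  intro J _ _ _
  refine ⟨fun {D} => ⟨fun {c} hc => IsConcrete.nonempty_isColimit ?_⟩⟩
  have hc := hY.isConcrete_of_isColimit hc
  refine ⟨fun x => ?_, fun j y y' hyy => ?_⟩
  · obtain ⟨j, w, hw⟩ := hc.exists_rep_finite (σ c.pt x)
    obtain ⟨k, f, hf⟩ := hc.exists_satisfies hE (w := w) (by rw [hw]; exact h.satisfies _ x)
    obtain ⟨y, hy⟩ := h.exists_eq _ _ hf
    refine ⟨k, y, h.injective _ ((h.natural (c.ι.app k) y).trans ?_)⟩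
    rw [hy, ← hw]
    exact funext fun i => cocone_app_map c f (w i)
  · have := (h.natural (c.ι.app j) y).symm.trans ((congrArg _ hyy).trans (h.natural _ y'))
    obtain ⟨k, f, hf⟩ := hc.exists_eq_finite (congrFun this)
    exact ⟨k, f, h.injective _
      ((h.natural (D.map f) y).trans ((funext hf).trans (h.natural (D.map f) y').symm))⟩

end Adjunction

/-! ### Terms, equations and generalized quasi-equations in matrix powers -/

section MatrixPowers

variable {L : FirstOrder.Language.{u, 0}} {κ : Type}

/-- The components of a term in the language of matrix powers. -/
def matTerm {α : Type*} : (matrixLang L κ).Term α → κ → L.Term (α × κ)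
  | .var a => fun i => .var (a, i)
  | .func t ts => fun i => Term.subst (t i) fun p => matTerm (ts p.1) p.2

theorem realize_matTerm {α : Type*} (A : Alg.{u, u} L) (s : (matrixLang L κ).Term α)
    (v : α → κ → A.carrier) (i : κ) :
    (matTerm s i).realize (fun p => v p.1 p.2) =
      Term.realize (M := (matrixPower κ A).carrier) v s i := by
  induction s generalizing i with
  | var a => rfl
  | @func n t ts ih =>
    change (Term.subst (t i) fun p => matTerm (ts p.1) p.2).realize _ = _
    rw [Term.realize_subst]
    simp only [ih]
    rfl

/-- The `κ` equations that express a one-variable equation in the matrix power. -/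
def matEquation (p : Equation (matrixLang L κ) (Fin 1)) (i : κ) : Equation L κ :=
  ((matTerm p.1 i).relabel Prod.snd, (matTerm p.2 i).relabel Prod.snd)

theorem matEquation_holdsAt (A : Alg.{u, u} L) (p : Equation (matrixLang L κ) (Fin 1))
    (v : κ → A.carrier) :
    (∀ i, (matEquation p i).HoldsAt A v) ↔ p.HoldsAt (matrixPower κ A) fun _ => v := by
  unfold matEquation Equation.HoldsAt
  refine Iff.trans (forall_congr' fun i => ?_) (funext_iff (β := fun _ => A.carrier)).symm
  rw [Term.realize_relabel, Term.realize_relabel]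
  exact Eq.congr (realize_matTerm A p.1 (fun _ => v) i) (realize_matTerm A p.2 (fun _ => v) i)

theorem satisfies_matEquation (A : Alg.{u, u} L) (θ : Set (Equation (matrixLang L κ) (Fin 1)))
    (v : κ → A.carrier) : Satisfies (Set.image2 matEquation θ Set.univ) A v ↔
      v ∈ solutions θ (matrixPower κ A) := by
  simp only [Satisfies, Set.forall_mem_image2, Set.mem_univ, true_implies]
  exact forall₂_congr fun p _ => matEquation_holdsAt A p v

/-- The constant sequence of a term `s` in the variables `κ`, as a term in one variable of the
language of matrix powers. -/
def diagTerm (s : L.Term κ) : (matrixLang L κ).Term (Fin 1) :=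
  Term.func (L := matrixLang L κ) (l := 1) (fun _ : κ => s.relabel fun i => ((0 : Fin 1), i))
    Term.var

theorem realize_diagTerm (A : Alg.{u, u} L) (s : L.Term κ) (v : κ → A.carrier) :
    Term.realize (M := (matrixPower κ A).carrier) (fun _ => v) (diagTerm s) =
      fun _ => s.realize v := by
  funext i
  exact Term.realize_relabel (M := A.carrier) (t := s)

/-- A set of equations in the variables `κ`, as a set of equations in one variable in the language
of matrix powers. -/
def diagEquations (E : Set (Equation L κ)) : Set (Equation (matrixLang L κ) (Fin 1)) :=
  (fun p => (diagTerm p.1, diagTerm p.2)) '' E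

/-- Both sides of a diagonal equation are constant sequences, so it says the original equation once
per index; at least one index is needed to recover it. -/
theorem mem_solutions_diagEquations [Nonempty κ] (A : Alg.{u, u} L) (E : Set (Equation L κ))
    (v : κ → A.carrier) :
    v ∈ solutions (diagEquations E) (matrixPower κ A) ↔ Satisfies E A v := by
  refine Set.forall_mem_image.trans (forall₂_congr fun p _ => ?_)
  change Term.realize (M := (matrixPower κ A).carrier) (fun _ => v) (diagTerm p.1) =
    Term.realize (M := (matrixPower κ A).carrier) (fun _ => v) (diagTerm p.2) ↔ _
  rw [realize_diagTerm, realize_diagTerm]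
  exact ⟨fun h => congrFun h (Classical.arbitrary κ), fun h => funext fun _ => h⟩

/-- The class of algebras that satisfy all generalized quasi-equations in countably many variables
that are valid in the matrix powers of the algebras of `Y`. -/
def matrixPowerClass (Y : ObjectProperty (Alg.{u, u} L)) (κ : Type) :
    ObjectProperty (Alg.{u, u} (matrixLang L κ)) :=
  fun B => ∀ Φ : GenQuasiEquation (matrixLang L κ) (ULift.{u} ℕ),
    (∀ A, Y A → Φ.Holds (matrixPower κ A)) → Φ.Holds B

theorem matrixPowerClass_isGenQuasivariety (Y : ObjectProperty (Alg.{u, u} L)) (κ : Type) :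
    IsGenQuasivariety (matrixPowerClass Y κ) :=
  ⟨ULift.{u} ℕ, {Φ | ∀ A, Y A → Φ.Holds (matrixPower κ A)}, fun _ => Iff.rfl⟩

theorem matrixPower_mem (Y : ObjectProperty (Alg.{u, u} L)) {A : Alg.{u, u} L} (hA : Y A) :
    matrixPowerClass Y κ (matrixPower κ A) :=
  fun _ h => h A hA

theorem holdsAt_relabel {L' : FirstOrder.Language.{u, 0}} {α β : Type*} (p : Equation L' α)
    (f : α → β) (A : Alg.{u, u} L') (v : β → A.carrier) :
    Equation.HoldsAt (p.1.relabel f, p.2.relabel f) A v ↔ p.HoldsAt A (v ∘ f) := by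
  unfold Equation.HoldsAt
  rw [Term.realize_relabel, Term.realize_relabel]

/-- Validity in matrix powers transfers to the whole class after renaming the variables injectively
into `ℕ`. Both compatibility of `θ` and membership of the `θ`-algebras in `X` are obtained this way.
-/
theorem entails_matrixPowerClass {Y : ObjectProperty (Alg.{u, u} L)} {α : Type}
    [Countable α] {Φ : Set (Equation (matrixLang L κ) α)} {e : Equation (matrixLang L κ) α}
    (h : ∀ A, Y A → ∀ v : α → (matrixPower κ A).carrier,
      (∀ p ∈ Φ, Equation.HoldsAt p (matrixPower κ A) v) →
        Equation.HoldsAt e (matrixPower κ A) v) :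
    Entails (matrixPowerClass Y κ) Φ e := by
  intro B hB v hv
  obtain ⟨f, hf⟩ := exists_injective_nat α
  have hg : Function.Injective fun a => (ULift.up (f a) : ULift.{u} ℕ) :=
    ULift.up_injective.comp hf
  set g : α → ULift.{u} ℕ := fun a => ULift.up (f a)
  -- The default value for unused variables must be an element of `B` that exists even when `α` is
  -- empty; a value of the conclusion's left side serves.
  have hvg : Function.extend g v (fun _ => e.1.realize v) ∘ g = v :=
    funext fun a => hg.extend_apply v _ a
  have := hB ⟨(fun p => (p.1.relabel g, p.2.relabel g)) '' Φ, (e.1.relabel g, e.2.relabel g)⟩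
    (fun A hA w hw => (holdsAt_relabel e g _ w).2 (h A hA _ fun p hp =>
      (holdsAt_relabel p g _ w).1 (hw _ ⟨p, hp, rfl⟩)))
    (Function.extend g v fun _ => e.1.realize v) (by
      rintro _ ⟨p, hp, rfl⟩
      rw [holdsAt_relabel, hvg]
      exact hv p hp)
  exact hvg ▸ (holdsAt_relabel e g B _).1 this

theorem subst_holdsAt {L' : FirstOrder.Language.{u, 0}} {α β : Type*} (e : Equation L' α)
    (σ : α → L'.Term β) (A : Alg.{u, u} L') (v : β → A.carrier) :
    (e.subst σ).HoldsAt A v ↔ e.HoldsAt A fun i => (σ i).realize v := by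
  unfold Equation.HoldsAt Equation.subst
  rw [Term.realize_subst, Term.realize_subst]

theorem forall_subst_var_holdsAt {L' : FirstOrder.Language.{u, 0}} {α : Type*}
    (θ : Set (Equation L' (Fin 1))) (A : Alg.{u, u} L') (v : α → A.carrier) :
    (∀ q ∈ {q | ∃ i : α, ∃ p ∈ θ, q = Equation.subst p fun _ => Term.var i},
      Equation.HoldsAt q A v) ↔ ∀ i, v i ∈ solutions θ A := by
  constructor
  · intro h i p hp
    exact (subst_holdsAt _ _ _ _).1 (h _ ⟨i, p, hp, rfl⟩)
  · rintro h _ ⟨i, p, hp, rfl⟩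
    exact (subst_holdsAt _ _ _ _).2 (h i p hp)

theorem realize_thetaAlg {L' L'' : FirstOrder.Language.{u, 0}} [L'.IsAlgebraic] {τ : L' →ᴸ L''}
    {θ : Set (Equation L'' (Fin 1))} {K : ObjectProperty (Alg.{u, u} L'')}
    (h : IsCompatible τ θ K) (A : K.FullSubcategory) {α : Type*} (t : L'.Term α)
    (v : α → (thetaAlg h A).carrier) :
    (t.realize v).1 = (τ.onTerm t).realize fun i => (v i).1 := by
  induction t with
  | var i => rfl
  | func f ts ih => exact congrArg (Structure.funMap (τ.onFunction f)) (funext ih)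

end MatrixPowers

/-! ### From solution sets to decompositions and back -/

section Decomposition

variable {LX LY : FirstOrder.Language.{u, 0}} [LX.IsAlgebraic] [LY.IsAlgebraic]
  {X : ObjectProperty (Alg.{u, u} LX)} {Y : ObjectProperty (Alg.{u, u} LY)}
  {F : X.FullSubcategory ⥤ Y.FullSubcategory} {G : Y.FullSubcategory ⥤ X.FullSubcategory}

theorem DecomposesFinitely.exists_represents (h : DecomposesFinitely X Y G) :
    ∃ (n : ℕ) (E : Set (Equation LY (Fin n))) (σ : _), E.Finite ∧ Represents G E σ := by
  obtain ⟨k, -, K, -, hKY, τ, θ, hfin, hθ, hKX, ⟨e⟩⟩ := h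
  refine ⟨k, Set.image2 matEquation θ Set.univ,
    fun B x => (asHom (e.hom.app B) x : solutions θ (matrixPower (Fin k) B.obj)).1,
    hfin.image2 _ Set.finite_univ, fun {B C} f x => ?_, fun B x y hxy => ?_, fun B x => ?_,
    fun B w hw => ?_⟩
  · rw [← asHom_comp, e.hom.naturality]
    rfl
  · exact asHom_injective_of_iso (e.app B) (Subtype.ext hxy)
  · exact (satisfies_matEquation _ _ _).2
      (asHom (e.hom.app B) x : solutions θ (matrixPower (Fin k) B.obj)).2
  · obtain ⟨x, hx⟩ := asHom_surjective_of_iso (e.app B)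
      (⟨w, (satisfies_matEquation _ _ _).1 hw⟩ : solutions θ (matrixPower (Fin k) B.obj))
    exact ⟨x, congrArg Subtype.val hx⟩

/-- Yoneda argument: `P`, presented by `n` disjoint copies of `E`, carries the generic `n`-tuple `a`
of elements of `G P`. The coordinates of `ψ` applied to `a` are terms in the generators of `P`, and
naturality of `σ` carries these terms to every tuple in every `G B`. -/
theorem Represents.exists_terms (hY : IsQuasivariety Y) {k : ℕ} {E : Set (Equation LY (Fin k))}
    {σ : ∀ B : Y.FullSubcategory, (G.obj B).obj.carrier → Fin k → B.obj.carrier}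
    (h : Represents G E σ) {n : ℕ} (ψ : LX.Functions n) :
    ∃ t : Fin k → LY.Term (Fin n × Fin k), ∀ (B : Y.FullSubcategory)
      (b : Fin n → (G.obj B).obj.carrier),
      σ B (Structure.funMap ψ b) = fun i => (t i).realize fun p => σ B (b p.1) p.2 := by
  let E' : Set (Equation LY (Fin n × Fin k)) :=
    {q | ∃ m : Fin n, ∃ p ∈ E, q = (p.1.relabel (Prod.mk m), p.2.relabel (Prod.mk m))}
  have hE' : ∀ (A : Alg.{u, u} LY) (w : Fin n × Fin k → A.carrier),
      Satisfies E' A w ↔ ∀ m, Satisfies E A fun i => w (m, i) := by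
    intro A w
    constructor
    · exact fun hw m p hp => (holdsAt_relabel p _ A w).1 (hw _ ⟨m, p, hp, rfl⟩)
    · rintro hw _ ⟨m, p, hp, rfl⟩
      exact (holdsAt_relabel p _ A w).2 (hw m p hp)
  let P : Y.FullSubcategory :=
    ⟨(presCongruence Y E').quotient, hY.presCongruence_isRelative E'⟩
  obtain ⟨g, hg⟩ : ∃ g : Fin n × Fin k → P.obj.carrier, IsPresentedBy Y P.obj g E' :=
    ⟨_, presCongruence_isPresentedBy Y E'⟩
  choose a ha using fun m => h.exists_eq P _ ((hE' _ _).1 hg.satisfies m)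
  choose t ht using fun i => hg.generates (σ P (Structure.funMap ψ a) i)
  refine ⟨t, fun B b => ?_⟩
  obtain ⟨f, hf⟩ := hg.exists_hom B.property (w := fun p => σ B (b p.1) p.2)
    ((hE' _ _).2 fun m => h.satisfies B (b m))
  have hb : ∀ m, asHom (G.map (ofHom (A := P) f)) (a m) = b m := fun m =>
    h.injective B ((h.natural _ _).trans (by
      rw [ha]
      exact funext fun i => hf (Term.var (m, i))))
  rw [← funext hb, ← map_funMap, h.natural, funext hb]
  funext i
  rw [← ht, ← hf]
  rfl

theorem Represents.decomposesFinitely (hX : IsQuasivariety X) (hY : IsQuasivariety Y) {k : ℕ}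
    (hk : 0 < k) {E : Set (Equation LY (Fin k))}
    {σ : ∀ B : Y.FullSubcategory, (G.obj B).obj.carrier → Fin k → B.obj.carrier}
    (h : Represents G E σ) (hE : E.Finite) : DecomposesFinitely X Y G := by
  have : Nonempty (Fin k) := ⟨⟨0, hk⟩⟩
  choose t ht using fun (n : ℕ) (ψ : LX.Functions n) => h.exists_terms hY ψ
  let τ : LX →ᴸ matrixLang LY (Fin k) := ⟨fun {n} ψ => t n ψ, fun {_} r => isEmptyElim r⟩
  let K := matrixPowerClass Y (Fin k)
  have hmem : ∀ (A : Alg.{u, u} LY) (hA : Y A) (v : (matrixPower (Fin k) A).carrier),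
      v ∈ solutions (diagEquations E) (matrixPower (Fin k) A) ↔ ∃ x, σ ⟨A, hA⟩ x = v :=
    fun A hA v => (mem_solutions_diagEquations A E v).trans
      ⟨h.exists_eq ⟨A, hA⟩ v, fun ⟨x, hx⟩ => hx ▸ h.satisfies ⟨A, hA⟩ x⟩
  have hτ : ∀ (A : Y.FullSubcategory) {n : ℕ} (ψ : LX.Functions n)
      (b : Fin n → (G.obj A).obj.carrier),
      σ A (Structure.funMap ψ b) = Structure.funMap (L := matrixLang LY (Fin k))
        (M := (matrixPower (Fin k) A.obj).carrier) (τ.onFunction ψ) fun m => σ A (b m) :=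
    fun A n ψ b => ht n ψ A b
  have hθ : IsCompatible τ (diagEquations E) K := by
    intro n ψ e he
    refine entails_matrixPowerClass fun A hA v hv => ?_
    rw [forall_subst_var_holdsAt] at hv
    choose x hx using fun i => (hmem A hA _).1 (hv i)
    refine (subst_holdsAt _ _ _ _).2 ?_
    have : σ ⟨A, hA⟩ (Structure.funMap ψ x) ∈
      solutions (diagEquations E) (matrixPower (Fin k) A) := (hmem A hA _).2 ⟨_, rfl⟩
    rw [hτ, funext hx] at this
    exact this e he
  have hterm : ∀ (A : Y.FullSubcategory) {α : Type} (s : LX.Term α)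
      (b : α → (G.obj A).obj.carrier), σ A (s.realize b) =
        Term.realize (M := (matrixPower (Fin k) A.obj).carrier) (fun i => σ A (b i))
          (τ.onTerm s) := by
    intro A α s b
    induction s with
    | var i => rfl
    | func f ts ih =>
      rw [Term.realize_func, hτ]
      exact congrArg (Structure.funMap (L := matrixLang LY (Fin k))
        (M := (matrixPower (Fin k) A.obj).carrier) (τ.onFunction f)) (funext ih)
  have hKX : ∀ B : K.FullSubcategory, X (thetaAlg hθ B) := by
    have hX' := hX
    obtain ⟨S, -, hS⟩ := hX'
    intro B
    refine (hS _).2 fun Φ hΦ v hv => Subtype.ext ?_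
    rw [realize_thetaAlg, realize_thetaAlg]
    -- A quasi-equation on the solution algebra becomes a generalized quasi-equation on `B`: the
    -- translated premises, together with `θ` for each of the countably many variables. In matrix
    -- powers of `Y` it holds because the solutions of `θ` there form a copy of `G A`, which is in
    -- `X`.
    refine entails_matrixPowerClass (Y := Y)
      (Φ := {q | ∃ i : ℕ, ∃ p ∈ diagEquations E, q = Equation.subst p fun _ => Term.var i} ∪
        (fun p => (τ.onTerm p.1, τ.onTerm p.2)) '' Φ.premises)
      (e := (τ.onTerm Φ.conclusion.1, τ.onTerm Φ.conclusion.2)) (fun A hA w hw => ?_)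
      B.obj B.property (fun i => (v i).1) ?_
    · rw [Set.union_def] at hw
      have hw₁ := (forall_subst_var_holdsAt (diagEquations E) (matrixPower (Fin k) A) w).1
        fun q hq => hw q (Or.inl hq)
      choose x hx using fun i => (hmem A hA _).1 (hw₁ i)
      obtain rfl := funext hx
      have := (hS _).1 (G.obj ⟨A, hA⟩).property Φ hΦ x fun p hp => h.injective _ (by
        rw [hterm, hterm]
        exact hw _ (Or.inr ⟨p, hp, rfl⟩))
      have := congrArg (σ ⟨A, hA⟩) this
      rwa [hterm, hterm] at this
    · rintro q (hq | ⟨p, hp, rfl⟩)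
      · exact (forall_subst_var_holdsAt _ _ _).2 (fun i => (v i).2) q hq
      · have := congrArg Subtype.val (hv p hp)
        rwa [realize_thetaAlg, realize_thetaAlg] at this
  refine ⟨k, hk, K, matrixPowerClass_isGenQuasivariety Y _, fun A => matrixPower_mem Y A.property,
    τ, diagEquations E, hE.image _, hθ, hKX, ⟨?_⟩⟩
  let Z : Y.FullSubcategory → X.FullSubcategory := fun A =>
    ⟨thetaAlg hθ ⟨matrixPower (Fin k) A.obj, matrixPower_mem Y A.property⟩, hKX _⟩
  let φ : ∀ A : Y.FullSubcategory, (G.obj A).obj.carrier →[LX] (Z A).obj.carrier := fun A =>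
    mkHom (fun x => (⟨σ A x, (hmem A.obj A.property _).2 ⟨x, rfl⟩⟩ :
      solutions (diagEquations E) (matrixPower (Fin k) A.obj)))
      fun ψ x => Subtype.ext (hτ A ψ x)
  have hφ : ∀ A, Function.Bijective (φ A) := fun A =>
    ⟨fun x y hxy => h.injective A (congrArg Subtype.val hxy), fun y => by
      obtain ⟨x, hx⟩ := (hmem A.obj A.property _).1 y.2
      exact ⟨x, Subtype.ext hx⟩⟩
  let e : ∀ A, G.obj A ≅ Z A := fun A =>
    { hom := ofHom (φ A)
      inv := ofHom (equivOfBijective (φ A) (hφ A)).symm.toHom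
      hom_inv_id := arrow_ext fun x => (equivOfBijective (φ A) (hφ A)).symm_apply_apply x
      inv_hom_id := arrow_ext fun x => (equivOfBijective (φ A) (hφ A)).apply_symm_apply x }
  exact NatIso.ofComponents e fun f => arrow_ext fun x => Subtype.ext (h.natural f x)

theorem isEmpty_term_of_isEmpty_constants (L : FirstOrder.Language.{u, 0}) [IsEmpty L.Constants]
    {α : Type*} [IsEmpty α] : IsEmpty (L.Term α) := by
  refine ⟨fun t => ?_⟩
  induction t with
  | var a => exact isEmptyElim a
  | @func n f ts ih =>
    cases n with
    | zero => exact isEmptyElim (f : L.Constants)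
    | succ n => exact ih 0

/-- Without constants there are no closed terms, so `E` is empty and each `G B` is a single point,
hence terminal. Then there is exactly one arrow from `A` to `G B`, so exactly one from `F A` to `B`.
-/
theorem Represents.isTrivialPair (adj : F ⊣ G) [IsEmpty LY.Constants]
    {E : Set (Equation LY (Fin 0))}
    {σ : ∀ B : Y.FullSubcategory, (G.obj B).obj.carrier → Fin 0 → B.obj.carrier}
    (h : Represents G E σ) : IsTrivialPair F G := by
  have := isEmpty_term_of_isEmpty_constants LY (α := Fin 0)
  have hsub : ∀ B, Subsingleton (G.obj B).obj.carrier := fun B => (h.injective B).subsingleton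
  have hterm : ∀ B, Nonempty (Limits.IsTerminal (G.obj B)) := fun B => by
    obtain ⟨x, -⟩ := h.exists_eq B Fin.elim0 fun e _ => isEmptyElim e.1
    exact ⟨Limits.IsTerminal.ofUniqueHom
      (fun A => ofHom (mkHom (fun _ => x) fun _ _ => Subsingleton.elim _ _))
      fun A f => arrow_ext fun a => Subsingleton.elim _ _⟩
  exact ⟨fun A => ⟨Limits.IsInitial.ofUniqueHom
    (fun B => (adj.homEquiv _ _).symm ((hterm B).some.from A))
    fun B f => ((adj.homEquiv _ _).eq_symm_apply.2 ((hterm B).some.hom_ext _ _))⟩, hterm⟩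

/-- A dummy coordinate, pinned to the value of `c` by one more equation, makes the exponent positive
without changing the solutions. -/
theorem Represents.of_constant (c : LY.Constants) {E : Set (Equation LY (Fin 0))}
    {σ : ∀ B : Y.FullSubcategory, (G.obj B).obj.carrier → Fin 0 → B.obj.carrier}
    (h : Represents G E σ) (hE : E.Finite) :
    ∃ (E' : Set (Equation LY (Fin 1))) (σ' : _), E'.Finite ∧ Represents G E' σ' := by
  let t : LY.Term (Fin 1) := Term.func c Fin.elim0
  have ht : ∀ (A : Alg.{u, u} LY) (v : Fin 1 → A.carrier),
      t.realize v = Structure.funMap c Fin.elim0 := fun A v => by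
    rw [Term.realize_func]
    exact congrArg _ (Subsingleton.elim _ _)
  refine ⟨insert (Term.var 0, t) ((fun p => (p.1.relabel Fin.elim0, p.2.relabel Fin.elim0)) '' E),
    fun B _ _ => Structure.funMap c Fin.elim0, (hE.image _).insert _, fun f x => ?_,
    fun B x y _ => h.injective B (Subsingleton.elim _ _), fun B x => ?_, fun B w hw => ?_⟩
  · funext i
    rw [map_funMap]
    exact congrArg _ (Subsingleton.elim _ _)
  · rintro _ (rfl | ⟨p, hp, rfl⟩)
    · exact (ht _ _).symm
    · rw [holdsAt_relabel, Subsingleton.elim (_ ∘ _) (σ B x)]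
      exact h.satisfies B x p hp
  · obtain ⟨x, -⟩ := h.exists_eq B Fin.elim0 fun p hp => by
      have := hw _ (Or.inr ⟨p, hp, rfl⟩)
      rwa [holdsAt_relabel, Subsingleton.elim (_ ∘ _) Fin.elim0] at this
    refine ⟨x, funext fun i => ?_⟩
    have : w 0 = t.realize w := hw _ (Or.inl rfl)
    rw [Subsingleton.elim i 0, this, ht]

end Decomposition

end QuasiVar

/-! ### The equivalences -/

open FirstOrder CategoryTheory QuasiVar in
theorem lemma5p4 (LX LY : FirstOrder.Language.{u, 0}) [LX.IsAlgebraic] [LY.IsAlgebraic]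
    (X : ObjectProperty (Alg.{u, u} LX)) (Y : ObjectProperty (Alg.{u, u} LY))
    (hX : IsQuasivariety X) (hY : IsQuasivariety Y)
    (F : X.FullSubcategory ⥤ Y.FullSubcategory) (G : Y.FullSubcategory ⥤ X.FullSubcategory)
    (adj : F ⊣ G) :
    List.TFAE
      [∀ A : X.FullSubcategory, IsFinPresentable X A → IsFinPresentable Y (F.obj A),
        IsFinPresentable Y (F.obj (hX.free (Fin 1))),
        PreservesDirectedColimits G] ∧
    ((¬ IsTrivialPair F G ∨ Nonempty LY.Constants) →
      (PreservesDirectedColimits G ↔ DecomposesFinitely X Y G)) := by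
  refine ⟨?_, fun hnt => ⟨fun hG => ?_, fun hG => ?_⟩⟩
  · tfae_have 1 → 2 := fun h => h _ (free_isFinPresentable hX 1)
    tfae_have 2 → 3 := fun h => by
      obtain ⟨n, E, σ, hE, hσ⟩ := exists_represents hX hY adj h
      exact hσ.preservesDirectedColimits hY hE
    tfae_have 3 → 1 := fun h => preserves_finPresentable hX hY adj h
    tfae_finish
  · obtain ⟨n, E, σ, hE, hσ⟩ := exists_represents hX hY adj
      (preserves_finPresentable hX hY adj hG _ (free_isFinPresentable hX 1))
    -- The presentation may have no generators, while the exponent of a matrix power must be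
    -- positive; here the extra assumption on the adjunction or on the constants enters.
    rcases Nat.eq_zero_or_pos n with rfl | hn
    · rcases isEmpty_or_nonempty LY.Constants with hc | ⟨⟨c⟩⟩
      · exact (hnt.resolve_right (not_nonempty_iff.2 hc) (hσ.isTrivialPair adj)).elim
      · obtain ⟨E', σ', hE', hσ'⟩ := hσ.of_constant c hE
        exact hσ'.decomposesFinitely hX hY one_pos hE'
    · exact hσ.decomposesFinitely hX hY hn hE
  · obtain ⟨n, E, σ, hE, hσ⟩ := hG.exists_represents
    exact hσ.preservesDirectedColimits hY hE
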